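/- Let $F:[a,b]\to\mathbb R^n$ ($n\ge 1$, $a<b$) be Lipschitz with image $\Gamma=F([a,b])$. By a Lipschitz triangulation of a set we mean a presentation of it as a finite union of arcs $\gamma_i=h_i([0,1])$, where each $h_i:[0,1]\to\mathbb R^n$ is Lipschitz and injective with inverse $h_i^{-1}:\gamma_i\to[0,1]$ locally Lipschitz apart from the endpoints, and where for $i\ne j$ the set $\gamma_i\cap\gamma_j$ is either empty or a single point which is an endpoint of both arcs. Assume that $\Gamma$ has a Lipschitz triangulation and that $\pi_1(\Gamma)$ is a free group of rank $m\ge 1$. Let $C_1,\dots,C_m\subset\Gamma$ be the images of simple closed Lipschitz curves whose classes generate $H_1(\Gamma)=\pi_1(\Gamma)/[\pi_1(\Gamma),\pi_1(\Gamma)]$, let $C=C_1\cup\dots\cup C_m$, and let $h_1,\dots,h_k$ be a Lipschitz triangulation $\mathcal T$ of $C$, with arcs $\gamma_1,\dots,\gamma_k$. All cubes have sides parallel to the coordinate axes, and the radius of a cube is half of its side length. Assume: (*) there are pairwise disjoint open cubes $K_i\subset\mathbb R^n$ of radius $r_i>0$ with centers $c_i\in\gamma_i$, and indices $s_i\in\{1,\dots,n\}$,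 $1\le i\le k$, such that for each $i$ the set $K_i\cap\gamma_i$ is connected, $K_i\cap\gamma_j=\emptyset$ for all $j\ne i$, and the projection $\pi_{s_i}$ to the $s_i$-th coordinate is injective on $K_i\cap\gamma_i$. Let $\tfrac12K_i$ be the open cube with center $c_i$ and radius $r_i/2$, let $l_i$ be the linear measure of $\pi_{s_i}(\tfrac12K_i\cap\gamma_i)$, and put $r=\min_i r_i$, $l=\min_i l_i$, $L=\max_i\int_0^1\sum_{j=1}^n|h_{i,j}'(t)|\,dt$, where $h_i=(h_{i,1},\dots,h_{i,n})$. Let $d$ be the radius of a minimal closed cube containing $C$, and $$\bar N_{\mathcal T}=\left\lfloor\frac{2\pi nLd}{r\,l}\right\rfloor+1 .$$ For a nonnegative integer $N$ let $P(N)$ be the following statement: there are $m$ distinct pairs $\bigl((d_1,\dots,d_n),i\bigr)$ with $d_j\in\mathbb Z_{\ge 0}$, $\max_jd_j\le N$ and $1\le i\le n$ such that, for every Lipschitz map $G=(g_1,\dots,g_n):[\alpha,\beta]\to\mathbb R^n$ ($\alpha<\beta$) with $G(\alpha)=G(\beta)$ and image in $\Gamma$, each moment $$\int_\alpha^\beta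 g_1(t)^{e_1}\cdots g_n(t)^{e_n}\,g_{i'}'(t)\,dt\qquad(e_1,\dots,e_n\in\mathbb Z_{\ge 0},\ 1\le i'\le n)$$ is a linear combination of the $m$ moments $\int_\alpha^\beta g_1^{d_1}\cdots g_n^{d_n}g_i'\,dt$ given by these pairs, where the pairs and the real coefficients of the combination depend only on $\Gamma$ (the coefficients also on $e_1,\dots,e_n,i'$), not on $G$, $\alpha$, $\beta$. Then there is a smallest nonnegative integer $\widetilde N$ for which $P(\widetilde N)$ holds, and $$\max\left\{\left\lfloor\sqrt[n]{\frac mn}-1\right\rfloor,\,1\right\}\le\widetilde N\le\bar N_{\mathcal T}.$$ In particular $P(\bar N_{\mathcal T})$ holds. -/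

import Mathlib

open Set Topology MeasureTheory

noncomputable section

namespace MomentsCurve

/-- A parametrized Lipschitz arc: `h` is Lipschitz and injective on `[0,1]`, and the inverse map
`h ([0,1]) → [0,1]` is locally Lipschitz apart from the endpoints. Only the values of `h` on
`[0,1]` matter. The space `Fin n → ℝ` is `ℝⁿ` with the sup norm, which is irrelevant for being
(locally) Lipschitz. -/
structure IsLipschitzArc {n : ℕ} (h : ℝ → Fin n → ℝ) : Prop where
  lipschitz : ∃ K, LipschitzOnWith K h (Icc 0 1)
  injective : InjOn h (Icc 0 1)
  inverse_lipschitz : ∀ t ∈ Ioo (0 : ℝ) 1, ∃ K : ℝ, ∃ U ∈ 𝓝 (h t),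
    ∀ s ∈ Icc (0 : ℝ) 1, ∀ s' ∈ Icc (0 : ℝ) 1, h s ∈ U → h s' ∈ U → |s - s'| ≤ K * ‖h s - h s'‖

/-- The arc `γ` parametrized by `h`. -/
def arc {n : ℕ} (h : ℝ → Fin n → ℝ) : Set (Fin n → ℝ) := h '' Icc 0 1

/-- The arcs parametrized by `h 0, …, h (k - 1)` form a Lipschitz triangulation of the set `C`:
their union is `C`, and two distinct arcs are disjoint or meet in exactly one point, which is an
endpoint of both. -/
structure IsLipschitzTriangulation {n k : ℕ} (C : Set (Fin n → ℝ)) (h : Fin k → ℝ → Fin n → ℝ) :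
    Prop where
  isArc : ∀ i, IsLipschitzArc (h i)
  union : ⋃ i, arc (h i) = C
  subsingleton : ∀ i j, i ≠ j → (arc (h i) ∩ arc (h j)).Subsingleton
  endpoints : ∀ i j, i ≠ j →
    arc (h i) ∩ arc (h j) ⊆ ({h i 0, h i 1} : Set (Fin n → ℝ)) ∩ {h j 0, h j 1}

/-- A Lipschitz triangulable curve. -/
def LipschitzTriangulable {n : ℕ} (C : Set (Fin n → ℝ)) : Prop :=
  ∃ (k : ℕ) (h : Fin k → ℝ → Fin n → ℝ), IsLipschitzTriangulation C h

/-- A simple closed Lipschitz curve in `Γ`. -/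
def IsSimpleClosedLipschitz {n : ℕ} {Γ : Set (Fin n → ℝ)} {y : Γ} (p : Path y y) : Prop :=
  (∃ K, LipschitzWith K p) ∧ InjOn p {t | t ≠ 1}

/-- The classes of the closed curves `p j` generate `H₁(X) = π₁(X, x₀) / [π₁(X, x₀), π₁(X, x₀)]`,
where `X` is path connected. The class of a closed curve `p` with base point `y` is that of the loop
`q · p · q⁻¹`, with `q` a path from `x₀` to `y`; it does not depend on the choice of `q`. -/
def GenerateH1 {X : Type*} [TopologicalSpace X] (x₀ : X) {ι : Type*} {y : ι → X}
    (p : ∀ j, Path (y j) (y j)) : Prop :=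
  Subgroup.closure {g : Abelianization (FundamentalGroup X x₀) |
    ∃ (j : ι) (q : Path x₀ (y j)), g = Abelianization.of
      (FundamentalGroup.fromPath (Path.Homotopic.Quotient.mk ((q.trans (p j)).trans q.symm)))} = ⊤

/-- The union `C` of the images of the closed curves `p j`. -/
def curveUnion {n m : ℕ} {Γ : Set (Fin n → ℝ)} {y : Fin m → Γ} (p : ∀ j, Path (y j) (y j)) :
    Set (Fin n → ℝ) :=
  ⋃ j, range fun t => (p j t : Fin n → ℝ)

/-- The cube condition for the arcs `γ i = arc (h i)`. The ball of the sup norm with center `c i` and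
radius `r i` is the open cube `K i` with sides parallel to the axes and side length `2 * r i`; the
projection to the `s i`-th axis is identified with the `s i`-th coordinate. -/
structure CubeCondition {n k : ℕ} (h : Fin k → ℝ → Fin n → ℝ) (c : Fin k → Fin n → ℝ)
    (r : Fin k → ℝ) (s : Fin k → Fin n) : Prop where
  radius_pos : ∀ i, 0 < r i
  center_mem : ∀ i, c i ∈ arc (h i)
  disjoint_cubes : ∀ i j, i ≠ j → Disjoint (Metric.ball (c i) (r i)) (Metric.ball (c j) (r j))
  connected : ∀ i, IsConnected (Metric.ball (c i) (r i) ∩ arc (h i))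
  disjoint_arcs : ∀ i j, j ≠ i → Metric.ball (c i) (r i) ∩ arc (h j) = ∅
  injective : ∀ i, InjOn (fun x : Fin n → ℝ => x (s i)) (Metric.ball (c i) (r i) ∩ arc (h i))

/-- The linear measure `l i` of the projection to the `s i`-th axis of the part of `γ i` that lies in
the cube homothetic to `K i` with respect to its center, with ratio `1/2`. -/
def projLength {n k : ℕ} (h : Fin k → ℝ → Fin n → ℝ) (c : Fin k → Fin n → ℝ)
    (r : Fin k → ℝ) (s : Fin k → Fin n) (i : Fin k) : ℝ :=
  (volume ((fun x : Fin n → ℝ => x (s i)) '' (Metric.ball (c i) (r i / 2) ∩ arc (h i)))).toReal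

/-- The `ℓ₁`-length of the arc parametrized by `h`. -/
def arcLength {n : ℕ} (h : ℝ → Fin n → ℝ) : ℝ :=
  ∫ t in (0 : ℝ)..1, ∑ j, |deriv (fun u => h u j) t|

/-- The radius (half of the side length) of a minimal closed cube, with sides parallel to the axes,
that contains `C`. -/
def cubeRadius {n : ℕ} (C : Set (Fin n → ℝ)) : ℝ :=
  sInf {ρ : ℝ | ∃ c : Fin n → ℝ, C ⊆ Metric.closedBall c ρ}

/-- The number `⌊2 π n L d / (r l)⌋ + 1`, where `L` is the largest `ℓ₁`-length of an arc, `d` the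
radius of a minimal cube containing `C`, `r` the smallest radius of the cubes `K i`, and `l` the
smallest of the numbers `l i`. (Extrema over `Fin k`, which is nonempty if `C` is.) -/
def boundN {n k : ℕ} (C : Set (Fin n → ℝ)) (h : Fin k → ℝ → Fin n → ℝ) (c : Fin k → Fin n → ℝ)
    (r : Fin k → ℝ) (s : Fin k → Fin n) : ℕ :=
  ⌊2 * Real.pi * n * (⨆ i, arcLength (h i)) * cubeRadius C /
    ((⨅ i, r i) * ⨅ i, projLength h c r s i)⌋₊ + 1

/-- The moment `∫ g₁ ^ d₁ ⋯ gₙ ^ dₙ gᵢ'` over `[a,b]`. -/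
def moment {n : ℕ} (a b : ℝ) (G : ℝ → Fin n → ℝ) (d : Fin n → ℕ) (i : Fin n) : ℝ :=
  ∫ t in a..b, (∏ j, G t j ^ d j) * deriv (fun u => G u i) t

/-- `G` is a closed Lipschitz map from `[a,b]` to `Γ`. -/
structure IsClosedLipschitzMap {n : ℕ} (Γ : Set (Fin n → ℝ)) (a b : ℝ) (G : ℝ → Fin n → ℝ) :
    Prop where
  lipschitz : ∃ K, LipschitzOnWith K G (Icc a b)
  closed : G a = G b
  mapsTo : MapsTo G (Icc a b) Γ

/-- There are `m` distinct moments, with all exponents at most `N`, such that every moment is a real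
linear combination of them. The `m` moments and the coefficients depend only on `Γ`: they are the
same for all closed Lipschitz maps, on all intervals, with image in `Γ`. -/
def MomentsGenerated {n : ℕ} (Γ : Set (Fin n → ℝ)) (m N : ℕ) : Prop :=
  ∃ (D : Fin m → Fin n → ℕ) (I : Fin m → Fin n) (coeff : (Fin n → ℕ) → Fin n → Fin m → ℝ),
    Function.Injective (fun q => (D q, I q)) ∧ (∀ q j, D q j ≤ N) ∧
    ∀ (a b : ℝ) (G : ℝ → Fin n → ℝ), a < b → IsClosedLipschitzMap Γ a b G →
      ∀ (d : Fin n → ℕ) (i : Fin n),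
        moment a b G d i = ∑ q, coeff d i q * moment a b G (D q) (I q)

end MomentsCurve

end

noncomputable section
namespace MomentsCurve

/-! ### A positive polynomial kernel of Fejér–Korovkin type on a grid -/

/-! A form `P dx_s` sees a closed Lipschitz curve in `Γ` only through its homology class. Wrap one
arc of a triangulation around the circle and send all other points to `0`: this is a continuous
circle-valued map, and the integral over a closed curve is the sum over the arcs of the winding
number of this map times the integral over the arc (`lineIntegral_eq_sum`). Winding numbers are
homomorphisms on `H₁`, and the `m` given classes generate a free abelian group of rank `m`, so they
are a basis. Hence the moments of a closed curve are integer combinations of those of `C_1, …, C_m`,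
with the same integers for all moments (`exists_int_moment_eq_sum`). It remains to see that the
moments with exponents at most `N`, as vectors of their values on `C_1, …, C_m`, span `ℝ^m`: then
`m` of them form a basis.

A functional that kills these vectors is a real combination of the `C_j`, that is, a real
combination of the arcs `γ_i` with coefficients `β_i`. It is nonzero, because the integers that
express integrals over `C_j` by integrals over the arcs also express the class of `C_j` by classes
of arcs (`exists_int_lineIntegral_eq`), and the basis dual to the classes yields a left inverse. But
no nonzero combination of arcs kills all polynomial forms of the given degree
(`exists_sum_moment_ne_zero`). Bump functions of the cubes, with signs adapted to `β`, give a form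
whose integral over each `γ_i` has absolute value at least `l` and the sign of `β_i`. Its
coefficients have Lipschitz constant `2 / r`, so a Jackson theorem (`exists_polynomial_approx`)
approximates them on a cube of radius `R` within `2 π n R / (r (N + 2))`. Multiplied by the length
`L` of an arc this is less than `l` for `R` near `d`, by the choice of the upper bound.

For the lower bound, there are only `n (N + 1)^n` pairs with exponents at most `N`, and with all
exponents zero the moments of closed curves vanish. -/

theorem sum_cos_grid (M : ℕ) (hM : 0 < M) (m : ℤ) (hm0 : m ≠ 0) (hm : |m| < M) (θ : ℝ) :
    ∑ q ∈ Finset.range M, Real.cos (m * (θ + 2 * Real.pi * q / M)) = 0 := by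
  have hMc : (M : ℂ) ≠ 0 := by exact_mod_cast hM.ne'
  set ζ : ℂ := Complex.exp (2 * Real.pi * Complex.I * (m / M)) with hζ
  have h1 : ζ ^ M = 1 := by
    rw [hζ, ← Complex.exp_nat_mul, Complex.exp_eq_one_iff]
    exact ⟨m, by field_simp⟩
  have h2 : ζ ≠ 1 := by
    intro h
    rw [hζ, Complex.exp_eq_one_iff] at h
    obtain ⟨l, hl⟩ := h
    have h3 : (m : ℂ) = l * M := by
      have hpi : (2 * Real.pi * Complex.I : ℂ) ≠ 0 := Complex.two_pi_I_ne_zero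
      have : (2 * Real.pi * Complex.I : ℂ) * (m / M) = 2 * Real.pi * Complex.I * l := by
        rw [hl]; ring
      have := mul_left_cancel₀ hpi this
      field_simp at this
      rw [this]; ring
    have h4 : m = l * M := by exact_mod_cast h3
    have hl0 : l ≠ 0 := by rintro rfl; simp at h4; exact hm0 h4
    have : (1 : ℤ) ≤ |l| := Int.one_le_abs hl0
    rw [h4, abs_mul, Nat.abs_cast] at hm
    nlinarith
  have h3 : ∑ q ∈ Finset.range M, ζ ^ q = 0 := by
    have := mul_geom_sum ζ M
    rw [h1, sub_self] at this
    exact (mul_eq_zero.1 this).resolve_left (sub_ne_zero.2 h2)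
  have h4 : ∀ q ∈ Finset.range M, Real.cos (m * (θ + 2 * Real.pi * q / M)) =
      (Complex.exp ((m * θ : ℝ) * Complex.I) * ζ ^ q).re := by
    intro q _
    rw [hζ, ← Complex.exp_nat_mul, ← Complex.exp_add, ← Complex.exp_ofReal_mul_I_re]
    congr 2
    push_cast
    ring
  rw [Finset.sum_congr rfl h4, ← Complex.re_sum, ← Finset.mul_sum, h3]
  simp

/-- The trigonometric polynomial `|∑ b k e ^ (i k u)| ^ 2`. -/
def trigSq (M : ℕ) (b : ℕ → ℝ) (u : ℝ) : ℝ :=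
  ∑ j ∈ Finset.range M, ∑ k ∈ Finset.range M, b j * b k * Real.cos (((j : ℤ) - k : ℤ) * u)

theorem trigSq_eq (M : ℕ) (b : ℕ → ℝ) (u : ℝ) :
    trigSq M b u =
      Complex.normSq (∑ k ∈ Finset.range M, (b k : ℂ) * Complex.exp (u * Complex.I) ^ k) := by
  have h : ∀ k : ℕ, Complex.exp (u * Complex.I) ^ k =
      ⟨Real.cos (k * u), Real.sin (k * u)⟩ := by
    intro k
    rw [← Complex.exp_nat_mul]
    have : ((k : ℂ) * (u * Complex.I)) = ((k * u : ℝ) : ℂ) * Complex.I := by push_cast; ring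
    rw [this]
    apply Complex.ext
    · rw [Complex.exp_ofReal_mul_I_re]
    · rw [Complex.exp_ofReal_mul_I_im]
  rw [Complex.normSq_apply, Complex.re_sum, Complex.im_sum]
  simp only [h, Complex.re_ofReal_mul, Complex.im_ofReal_mul]
  rw [Finset.sum_mul_sum, Finset.sum_mul_sum, ← Finset.sum_add_distrib, trigSq]
  refine Finset.sum_congr rfl fun j _ => ?_
  rw [← Finset.sum_add_distrib]
  refine Finset.sum_congr rfl fun k _ => ?_
  push_cast
  rw [sub_mul, Real.cos_sub]
  ring

theorem trigSq_nonneg (M : ℕ) (b : ℕ → ℝ) (u : ℝ) : 0 ≤ trigSq M b u := by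
  rw [trigSq_eq]; exact Complex.normSq_nonneg _

/-- The frequencies are less than `K ≤ M` in absolute value, so on a grid of `M` points no aliasing
occurs and only the diagonal terms survive. -/
theorem sum_trigSq_grid (M K : ℕ) (hM : 0 < M) (hK : K ≤ M) (b : ℕ → ℝ) (θ : ℝ) :
    ∑ q ∈ Finset.range M, trigSq K b (θ + 2 * Real.pi * q / M) =
      M * ∑ k ∈ Finset.range K, b k ^ 2 := by
  simp only [trigSq]
  rw [Finset.sum_comm, Finset.mul_sum]
  refine Finset.sum_congr rfl fun j hj => ?_
  rw [Finset.sum_comm, Finset.sum_eq_single_of_mem j hj]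
  · simp only [sub_self, Int.cast_zero, zero_mul, Real.cos_zero, mul_one, Finset.sum_const,
      Finset.card_range, nsmul_eq_mul, sq]
  · intro k hk hkj
    rw [← Finset.mul_sum, sum_cos_grid M hM _ _ _ θ, mul_zero]
    · intro h; apply hkj; omega
    · rw [Finset.mem_range] at hj hk
      rw [abs_lt]; omega

/-- With `z = e^(iu)` the first factor is `|1 - z|^2`; multiplying a polynomial by `1 - z` replaces
its coefficients by their differences. -/
theorem two_sub_two_cos_mul_trigSq (N : ℕ) (α : ℕ → ℝ) (h0 : α 0 = 0) (h1 : α (N + 2) = 0)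
    (u : ℝ) : (2 - 2 * Real.cos u) * trigSq (N + 1) (fun k => α (k + 1)) u =
      trigSq (N + 2) (fun k => α (k + 1) - α k) u := by
  rw [trigSq_eq, trigSq_eq]
  set z := Complex.exp (u * Complex.I) with hz
  have h2 : 2 - 2 * Real.cos u = Complex.normSq (1 - z) := by
    rw [Complex.normSq_apply, hz]
    simp only [Complex.sub_re, Complex.sub_im, Complex.one_re, Complex.one_im,
      Complex.exp_ofReal_mul_I_re, Complex.exp_ofReal_mul_I_im]
    nlinarith [Real.sin_sq_add_cos_sq u]
  rw [h2, ← Complex.normSq_mul]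
  congr 1
  have h3 : ∑ k ∈ Finset.range (N + 2), ((α (k + 1) - α k : ℝ) : ℂ) * z ^ k =
      ∑ k ∈ Finset.range (N + 2), (α (k + 1) : ℂ) * z ^ k -
        ∑ k ∈ Finset.range (N + 2), (α k : ℂ) * z ^ k := by
    rw [← Finset.sum_sub_distrib]
    refine Finset.sum_congr rfl fun k _ => ?_
    push_cast; ring
  rw [h3, Finset.sum_range_succ (fun k => (α (k + 1) : ℂ) * z ^ k) (N + 1), Finset.sum_range_succ' (fun k => (α k : ℂ) * z ^ k), h0, h1,
    sub_mul, one_mul, Finset.mul_sum]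
  simp only [Complex.ofReal_zero, zero_mul, add_zero]
  congr 1
  refine Finset.sum_congr rfl fun k _ => ?_
  ring

/-- By `hrec`, the sequence is an eigenvector of the discrete Laplacian with zero boundary values;
this is the resulting summation by parts. It evaluates the second moment of the kernel. -/
theorem korovkin_sum (N : ℕ) (α : ℕ → ℝ) (c : ℝ) (h0 : α 0 = 0) (h1 : α (N + 2) = 0)
    (hrec : ∀ k, α (k + 2) + α k = 2 * c * α (k + 1)) :
    ∑ k ∈ Finset.range (N + 2), (α (k + 1) - α k) ^ 2 =
      (2 - 2 * c) * ∑ k ∈ Finset.range (N + 1), α (k + 1) ^ 2 := by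
  have e1 : ∑ k ∈ Finset.range (N + 2), α (k + 1) ^ 2 =
      ∑ k ∈ Finset.range (N + 1), α (k + 1) ^ 2 := by
    rw [Finset.sum_range_succ, h1]; simp
  have e2 : ∑ k ∈ Finset.range (N + 2), α k ^ 2 =
      ∑ k ∈ Finset.range (N + 1), α (k + 1) ^ 2 := by
    rw [Finset.sum_range_succ', h0]; simp
  have e3 : ∑ k ∈ Finset.range (N + 2), α k * α (k + 1) =
      ∑ k ∈ Finset.range (N + 1), α (k + 1) * α (k + 2) := by
    rw [Finset.sum_range_succ', h0]; simp
  have e4 : ∑ k ∈ Finset.range (N + 2), α k * α (k + 1) =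
      ∑ k ∈ Finset.range (N + 1), α (k + 1) * α k := by
    rw [Finset.sum_range_succ, h1]
    simp only [mul_zero, add_zero]
    exact Finset.sum_congr rfl fun k _ => mul_comm _ _
  have e5 : 2 * ∑ k ∈ Finset.range (N + 2), α k * α (k + 1) =
      2 * c * ∑ k ∈ Finset.range (N + 1), α (k + 1) ^ 2 := by
    rw [two_mul]
    nth_rw 1 [e3]
    rw [e4, ← Finset.sum_add_distrib, Finset.mul_sum]
    refine Finset.sum_congr rfl fun k _ => ?_
    have := hrec k
    linear_combination α (k + 1) * this
  have e6 : ∑ k ∈ Finset.range (N + 2), (α (k + 1) - α k) ^ 2 =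
      ∑ k ∈ Finset.range (N + 2), α (k + 1) ^ 2 + ∑ k ∈ Finset.range (N + 2), α k ^ 2 -
        2 * ∑ k ∈ Finset.range (N + 2), α k * α (k + 1) := by
    rw [← Finset.sum_add_distrib, Finset.mul_sum, ← Finset.sum_sub_distrib]
    refine Finset.sum_congr rfl fun k _ => ?_
    ring
  rw [e6, e1, e2, e5]
  ring

theorem sq_cos_sub_cos_le (a b : ℝ) :
    (Real.cos a - Real.cos b) ^ 2 ≤ 2 - 2 * Real.cos (a - b) := by
  rw [Real.cos_sub]
  nlinarith [Real.sin_sq_add_cos_sq a, Real.sin_sq_add_cos_sq b, sq_nonneg (Real.sin a - Real.sin b)]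

/-- Averaging the translates by `t` over `θ` and `-θ` cancels the sine terms; an even trigonometric
polynomial is a polynomial in `cos θ`, through Chebyshev polynomials. -/
theorem eval_cos_kernel (K : ℕ) (a : ℕ → ℝ) (κ t θ : ℝ) :
    (∑ j ∈ Finset.range K, ∑ k ∈ Finset.range K, Polynomial.C (κ * (a j * a k *
      Real.cos (((j : ℤ) - k : ℤ) * t))) * Polynomial.Chebyshev.T ℝ ((j : ℤ) - k)).eval
        (Real.cos θ) = κ / 2 * (trigSq K a (-θ + t) + trigSq K a (θ + t)) := by
  rw [trigSq, trigSq, ← Finset.sum_add_distrib, Finset.mul_sum, Polynomial.eval_finsetSum]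
  refine Finset.sum_congr rfl fun j _ => ?_
  rw [← Finset.sum_add_distrib, Finset.mul_sum, Polynomial.eval_finsetSum]
  refine Finset.sum_congr rfl fun k _ => ?_
  rw [Polynomial.eval_mul, Polynomial.eval_C, Polynomial.Chebyshev.T_real_cos,
    mul_add, mul_add _ θ t, mul_add, Real.cos_add, Real.cos_add, mul_neg, Real.cos_neg,
    Real.sin_neg]
  ring

/-- Polynomials of degree at most `N`, nonnegative on `[-1,1]`, that form a partition of unity
concentrated near the points `y q`. -/
theorem exists_polynomial_kernel (N : ℕ) : ∃ (y : ℕ → ℝ) (p : ℕ → Polynomial ℝ),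
    (∀ q, (p q).natDegree ≤ N) ∧ ∀ x ∈ Icc (-1 : ℝ) 1,
      (∀ q, 0 ≤ (p q).eval x) ∧ ∑ q ∈ Finset.range (N + 2), (p q).eval x = 1 ∧
      ∑ q ∈ Finset.range (N + 2), (p q).eval x * |x - y q| ≤ Real.pi / (N + 2) := by
  set α : ℕ → ℝ := fun k => Real.sin (k * (Real.pi / (N + 2))) with hα
  have hN2 : (0 : ℝ) < N + 2 := by positivity
  have h0 : α 0 = 0 := by simp [hα]
  have h1 : α (N + 2) = 0 := by
    simp only [hα]; push_cast
    rw [mul_div_cancel₀ _ hN2.ne', Real.sin_pi]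
  have hrec : ∀ k, α (k + 2) + α k = 2 * Real.cos (Real.pi / (N + 2)) * α (k + 1) := by
    intro k
    simp only [hα]
    rw [Real.sin_add_sin]
    have e1 : (((k + 2 : ℕ) : ℝ) * (Real.pi / (N + 2)) + k * (Real.pi / (N + 2))) / 2 =
      ((k + 1 : ℕ) : ℝ) * (Real.pi / (N + 2)) := by push_cast; ring
    have e2 : (((k + 2 : ℕ) : ℝ) * (Real.pi / (N + 2)) - k * (Real.pi / (N + 2))) / 2 =
      Real.pi / (N + 2) := by push_cast; ring
    rw [e1, e2]; ring
  set S : ℝ := ∑ k ∈ Finset.range (N + 1), α (k + 1) ^ 2 with hS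
  have hSpos : 0 < S := by
    have : 0 < α 1 := by
      simp only [hα]
      apply Real.sin_pos_of_pos_of_lt_pi
      · positivity
      · push_cast
        rw [one_mul, div_lt_iff₀ hN2]
        nlinarith [Real.pi_pos]
    refine lt_of_lt_of_le (pow_pos this 2) ?_
    exact Finset.single_le_sum (f := fun k => α (k + 1) ^ 2) (fun k _ => sq_nonneg _)
      (Finset.mem_range.2 (Nat.succ_pos N))
  -- The grid has `N + 2` points because the kernel times `2 - 2 cos u` has frequencies up to `N +
  -- 1`; grid sums are still exact for it.
  set t : ℕ → ℝ := fun q => 2 * Real.pi * q / (N + 2 : ℕ) with ht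
  set p : ℕ → Polynomial ℝ := fun q => ∑ j ∈ Finset.range (N + 1), ∑ k ∈ Finset.range (N + 1),
    Polynomial.C (1 / ((N + 2) * S) * (α (j + 1) * α (k + 1) *
      Real.cos (((j : ℤ) - k : ℤ) * t q))) * Polynomial.Chebyshev.T ℝ ((j : ℤ) - k) with hp
  have heval : ∀ q θ, (p q).eval (Real.cos θ) = 1 / ((N + 2) * S) / 2 *
      (trigSq (N + 1) (fun k => α (k + 1)) (-θ + t q) +
        trigSq (N + 1) (fun k => α (k + 1)) (θ + t q)) :=
    fun q θ => eval_cos_kernel (N + 1) (fun k => α (k + 1)) _ _ _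
  have hgrid : ∀ K ≤ N + 2, ∀ (b : ℕ → ℝ) (θ : ℝ), ∑ q ∈ Finset.range (N + 2),
      trigSq K b (θ + t q) = (N + 2) * ∑ k ∈ Finset.range K, b k ^ 2 := fun K hK b θ => by
    rw [sum_trigSq_grid (N + 2) K (by omega) hK]; push_cast; rfl
  have hdeg : ∀ q, (p q).natDegree ≤ N := by
    intro q
    refine Polynomial.natDegree_sum_le_of_forall_le _ _ fun j hj => ?_
    refine Polynomial.natDegree_sum_le_of_forall_le _ _ fun k hk => ?_
    refine (Polynomial.natDegree_C_mul_le _ _).trans ?_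
    rw [Polynomial.Chebyshev.natDegree_T]
    rw [Finset.mem_range] at hj hk
    omega
  clear_value p t S α
  refine ⟨fun q => Real.cos (t q), p, hdeg, fun x hx => ?_⟩
  obtain ⟨θ, rfl⟩ : ∃ θ, x = Real.cos θ := ⟨Real.arccos x, (Real.cos_arccos hx.1 hx.2).symm⟩
  have hnn : ∀ q, 0 ≤ (p q).eval (Real.cos θ) := by
    intro q
    rw [heval]
    exact mul_nonneg (by positivity) (add_nonneg (trigSq_nonneg _ _ _) (trigSq_nonneg _ _ _))
  have hsum : ∑ q ∈ Finset.range (N + 2), (p q).eval (Real.cos θ) = 1 := by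
    simp only [heval]
    rw [← Finset.mul_sum, Finset.sum_add_distrib,
      hgrid (N + 1) (by omega), hgrid (N + 1) (by omega), ← hS]
    field_simp
    norm_num
  -- The second moment is estimated first, since `(cos θ - cos t)^2` is bounded by `2 - 2 cos (θ ±
  -- t)` and this factor is absorbed exactly by the kernel.
  have hsq : ∑ q ∈ Finset.range (N + 2), (p q).eval (Real.cos θ) *
      (Real.cos θ - Real.cos (t q)) ^ 2 ≤ (Real.pi / (N + 2)) ^ 2 := by
    have e1 : ∀ q ∈ Finset.range (N + 2), (p q).eval (Real.cos θ) *
        (Real.cos θ - Real.cos (t q)) ^ 2 ≤ 1 / ((N + 2) * S) / 2 *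
      (trigSq (N + 2) (fun k => α (k + 1) - α k) (-θ + t q) +
        trigSq (N + 2) (fun k => α (k + 1) - α k) (θ + t q)) := by
      intro q _
      rw [heval, ← two_sub_two_cos_mul_trigSq N α h0 h1, ← two_sub_two_cos_mul_trigSq N α h0 h1,
        mul_assoc]
      refine mul_le_mul_of_nonneg_left ?_ (by positivity)
      rw [add_mul]
      refine add_le_add ?_ ?_
      · rw [mul_comm]
        refine mul_le_mul_of_nonneg_right ?_ (trigSq_nonneg _ _ _)
        have := sq_cos_sub_cos_le (t q) θ
        rw [show -θ + t q = t q - θ by ring]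
        linarith [sq_nonneg (Real.cos θ - Real.cos (t q)),
          show (Real.cos θ - Real.cos (t q)) ^ 2 = (Real.cos (t q) - Real.cos θ) ^ 2 by ring]
      · rw [mul_comm]
        refine mul_le_mul_of_nonneg_right ?_ (trigSq_nonneg _ _ _)
        have := sq_cos_sub_cos_le θ (-t q)
        rwa [Real.cos_neg, sub_neg_eq_add] at this
    refine (Finset.sum_le_sum e1).trans ?_
    rw [← Finset.mul_sum, Finset.sum_add_distrib,
      hgrid (N + 2) le_rfl, hgrid (N + 2) le_rfl, korovkin_sum N α _ h0 h1 hrec, ← hS]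
    have : 2 - 2 * Real.cos (Real.pi / (N + 2)) ≤ (Real.pi / (N + 2)) ^ 2 := by
      linarith [Real.one_sub_sq_div_two_le_cos (x := Real.pi / (N + 2))]
    refine le_trans (le_of_eq ?_) this
    field_simp
    ring
  refine ⟨hnn, hsum, ?_⟩
  set ε := Real.pi / (N + 2) with hε
  have hεpos : 0 < ε := by positivity
  -- From second to first moment by `|v| ≤ ε / 2 + v^2 / (2 ε)`, which loses nothing at `|v| = ε`.
  have e2 : ∀ q ∈ Finset.range (N + 2), (p q).eval (Real.cos θ) * |Real.cos θ - Real.cos (t q)| ≤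
      ε / 2 * (p q).eval (Real.cos θ) + 1 / (2 * ε) * ((p q).eval (Real.cos θ) *
        (Real.cos θ - Real.cos (t q)) ^ 2) := by
    intro q _
    have : |Real.cos θ - Real.cos (t q)| ≤
        ε / 2 + 1 / (2 * ε) * (Real.cos θ - Real.cos (t q)) ^ 2 := by
      rw [← sq_abs (Real.cos θ - Real.cos (t q))]
      have : 0 ≤ (ε - |Real.cos θ - Real.cos (t q)|) ^ 2 / (2 * ε) := by positivity
      have e : (ε - |Real.cos θ - Real.cos (t q)|) ^ 2 / (2 * ε) =
        ε / 2 + 1 / (2 * ε) * |Real.cos θ - Real.cos (t q)| ^ 2 -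
          |Real.cos θ - Real.cos (t q)| := by field_simp; ring
      linarith
    nlinarith [mul_le_mul_of_nonneg_left this (hnn q)]
  refine (Finset.sum_le_sum e2).trans ?_
  rw [Finset.sum_add_distrib, ← Finset.mul_sum, ← Finset.mul_sum, hsum]
  have := mul_le_mul_of_nonneg_left hsq (show 0 ≤ 1 / (2 * ε) by positivity)
  have e3 : 1 / (2 * ε) * ε ^ 2 = ε / 2 := by field_simp
  linarith

/-- A Jackson type theorem on cubes: polynomial approximation of a Lipschitz function. -/
theorem exists_polynomial_approx {n : ℕ} (N : ℕ) (f : (Fin n → ℝ) → ℝ) (Λ : ℝ) (hΛ : 0 ≤ Λ)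
    (hf : ∀ x y, |f x - f y| ≤ Λ * ‖x - y‖) (c : Fin n → ℝ) (ρ : ℝ) (hρ : 0 < ρ) :
    ∃ A : (Fin n → Fin (N + 1)) → ℝ, ∀ x ∈ Metric.closedBall c ρ,
      |f x - ∑ D, A D * ∏ j, x j ^ (D j : ℕ)| ≤ Λ * ρ * n * (Real.pi / (N + 2)) := by
  obtain ⟨y, p, hdeg, hp⟩ := exists_polynomial_kernel N
  set pt : (Fin n → Fin (N + 2)) → Fin n → ℝ := fun q j => c j + ρ * y (q j) with hpt
  set P : ℕ → Fin n → Polynomial ℝ := fun q j =>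
    (p q).comp (Polynomial.C ρ⁻¹ * (Polynomial.X - Polynomial.C (c j))) with hP
  have hPdeg : ∀ q j, (P q j).natDegree < N + 1 := by
    intro q j
    refine Nat.lt_succ_of_le ((Polynomial.natDegree_comp_le).trans ?_)
    calc _ ≤ N * 1 := Nat.mul_le_mul (hdeg q) ((Polynomial.natDegree_C_mul_le _ _).trans (by simp))
      _ = N := mul_one N
  have hPeval : ∀ q j (x : ℝ), (P q j).eval x = (p q).eval ((x - c j) / ρ) := by
    intro q j x
    simp only [hP, Polynomial.eval_comp, Polynomial.eval_mul, Polynomial.eval_C,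
      Polynomial.eval_sub, Polynomial.eval_X]
    congr 1
    rw [div_eq_inv_mul]
  -- The approximant samples `f` at the grid points `pt q` with tensor products of the one-variable
  -- kernels as weights; these are its coefficients.
  refine ⟨fun D => ∑ q : Fin n → Fin (N + 2), f (pt q) * ∏ j, (P (q j) j).coeff (D j), ?_⟩
  intro x hx
  set w : Fin n → Fin (N + 2) → ℝ := fun j q => (p q).eval ((x j - c j) / ρ) with hw
  have hxj : ∀ j, (x j - c j) / ρ ∈ Icc (-1 : ℝ) 1 := by
    intro j
    have h1 : |x j - c j| ≤ ρ := by
      have := norm_le_pi_norm (x - c) j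
      rw [Metric.mem_closedBall, dist_eq_norm] at hx
      exact (by simpa using this : |x j - c j| ≤ ‖x - c‖).trans hx
    rw [abs_le] at h1
    constructor
    · rw [le_div_iff₀ hρ]; linarith
    · rw [div_le_iff₀ hρ]; linarith
  have hwnn : ∀ j q, 0 ≤ w j q := fun j q => (hp _ (hxj j)).1 q
  have hwsum : ∀ j, ∑ q, w j q = 1 := fun j => by
    rw [← (hp _ (hxj j)).2.1, Finset.sum_range]
  have hwerr : ∀ j, ∑ q, w j q * |(x j - c j) / ρ - y q| ≤ Real.pi / (N + 2) := fun j => by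
    refine le_trans (le_of_eq ?_) (hp _ (hxj j)).2.2
    rw [Finset.sum_range]
  have hpoly : ∑ D : Fin n → Fin (N + 1), (∑ q : Fin n → Fin (N + 2),
      f (pt q) * ∏ j, (P (q j) j).coeff (D j)) * ∏ j, x j ^ (D j : ℕ) =
      ∑ q : Fin n → Fin (N + 2), f (pt q) * ∏ j, w j (q j) := by
    simp only [Finset.sum_mul]
    rw [Finset.sum_comm]
    refine Finset.sum_congr rfl fun q _ => ?_
    have : ∀ j, w j (q j) = ∑ d : Fin (N + 1), (P (q j) j).coeff d * x j ^ (d : ℕ) := by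
      intro j
      simp only [hw]
      rw [← hPeval, Polynomial.eval_eq_sum_range' (hPdeg _ _), Finset.sum_range]
    simp only [this]
    rw [Finset.prod_univ_sum, Fintype.piFinset_univ, Finset.mul_sum]
    refine Finset.sum_congr rfl fun D _ => ?_
    rw [Finset.prod_mul_distrib, mul_assoc]
  rw [hpoly]
  have hone : ∑ q : Fin n → Fin (N + 2), ∏ j, w j (q j) = 1 := by
    rw [← Fintype.piFinset_univ, ← Finset.prod_univ_sum]
    simp [hwsum]
  have hfx : f x = ∑ q : Fin n → Fin (N + 2), f x * ∏ j, w j (q j) := by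
    rw [← Finset.mul_sum, hone, mul_one]
  rw [hfx, ← Finset.sum_sub_distrib]
  -- Bounding the sup norm by the sum over coordinates keeps each summand a product over `j`, so its
  -- sum over `q` factors: the `i`-th factor is a first moment, the others are `1`. This produces
  -- the factor `n`.
  have hterm : ∀ q : Fin n → Fin (N + 2), |f x * ∏ j, w j (q j) - f (pt q) * ∏ j, w j (q j)| ≤
      ∑ i, Λ * ρ * ∏ j, (w j (q j) * if j = i then |(x j - c j) / ρ - y (q j)| else 1) := by
    intro q
    have hprod : 0 ≤ ∏ j, w j (q j) := Finset.prod_nonneg fun j _ => hwnn _ _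
    rw [← sub_mul, abs_mul, abs_of_nonneg hprod]
    have e1 : ∀ i, ∏ j, (w j (q j) * if j = i then |(x j - c j) / ρ - y (q j)| else 1) =
        (∏ j, w j (q j)) * |(x i - c i) / ρ - y (q i)| := by
      intro i
      rw [Finset.prod_mul_distrib, Finset.prod_ite_eq' Finset.univ i]
      simp
    simp only [e1]
    have e2 : ‖x - pt q‖ ≤ ∑ i, ρ * |(x i - c i) / ρ - y (q i)| := by
      rw [pi_norm_le_iff_of_nonneg (Finset.sum_nonneg fun i _ => by positivity)]
      intro i
      refine le_trans (le_of_eq ?_) (Finset.single_le_sum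
        (f := fun i => ρ * |(x i - c i) / ρ - y (q i)|) (fun i _ => by positivity)
        (Finset.mem_univ i))
      simp only [hpt, Pi.sub_apply, Real.norm_eq_abs]
      nth_rw 2 [← abs_of_pos hρ]
      rw [← abs_mul]
      congr 1
      field_simp
      ring
    calc |f x - f (pt q)| * ∏ j, w j (q j)
        ≤ (Λ * ∑ i, ρ * |(x i - c i) / ρ - y (q i)|) * ∏ j, w j (q j) := by
          refine mul_le_mul_of_nonneg_right ?_ hprod
          exact (hf _ _).trans (mul_le_mul_of_nonneg_left e2 hΛ)
      _ = _ := by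
          rw [Finset.mul_sum, Finset.sum_mul]
          refine Finset.sum_congr rfl fun i _ => ?_
          ring
  refine (Finset.abs_sum_le_sum_abs _ _).trans ((Finset.sum_le_sum fun q _ => hterm q).trans ?_)
  rw [Finset.sum_comm]
  have hlast : ∀ i : Fin n, ∑ q : Fin n → Fin (N + 2), Λ * ρ * ∏ j, (w j (q j) *
      if j = i then |(x j - c j) / ρ - y (q j)| else 1) ≤ Λ * ρ * (Real.pi / (N + 2)) := by
    intro i
    rw [← Finset.mul_sum]
    refine mul_le_mul_of_nonneg_left ?_ (by positivity)
    rw [← Fintype.piFinset_univ, ← Finset.prod_univ_sum (fun _ => Finset.univ)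
      (fun j (q : Fin (N + 2)) => w j q * if j = i then |(x j - c j) / ρ - y q| else 1)]
    rw [Finset.prod_eq_single_of_mem i (Finset.mem_univ i)]
    · simpa using hwerr i
    · intro j _ hj
      simp [hj, hwsum]
  refine (Finset.sum_le_sum fun i _ => hlast i).trans (le_of_eq ?_)
  simp
  ring

end MomentsCurve
end

noncomputable section
namespace MomentsCurve

/-! ### Winding numbers of paths with respect to circle valued maps -/

open scoped unitInterval

theorem eq_of_coe_unitAddCircle_eq_zero {α : Type*} [TopologicalSpace α] {S : Set α}
    (hS : IsPreconnected S) {g : α → ℝ} (hg : ContinuousOn g S)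
    (h0 : ∀ t ∈ S, (g t : UnitAddCircle) = 0) {x y : α} (hx : x ∈ S) (hy : y ∈ S) :
    g x = g y := by
  have : DiscreteTopology (AddSubgroup.zmultiples (1 : ℝ)) := inferInstance
  refine hS.constant_of_mapsTo (T := (AddSubgroup.zmultiples (1 : ℝ) : Set ℝ))
    ((isDiscrete_iff_discreteTopology).2 this) hg (fun t ht => ?_) hx hy
  exact (AddCircle.coe_eq_zero_iff 1).1 (h0 t ht) |> fun ⟨k, hk⟩ => ⟨k, hk⟩

theorem exists_int_of_coe_eq_zero {x : ℝ} (h : (x : UnitAddCircle) = 0) : ∃ k : ℤ, x = k := by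
  obtain ⟨k, hk⟩ := (AddCircle.coe_eq_zero_iff 1).1 h
  exact ⟨k, by rw [← hk]; simp⟩

theorem exists_circle_lift (g : C(I, UnitAddCircle)) : ∃ θ : C(I, ℝ), ∀ t, (θ t : UnitAddCircle) = g t := by
  obtain ⟨e, he⟩ := QuotientAddGroup.mk_surjective (g 0)
  obtain ⟨Γ, hΓ, -⟩ := (AddCircle.isCoveringMap_coe (1 : ℝ)).exists_path_lifts g e he.symm
  exact ⟨Γ, fun t => congrFun hΓ t⟩

variable {X : Type*} [TopologicalSpace X]

/-- The total change of a lift of `f ∘ γ` to the real line. -/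
def winding (f : C(X, UnitAddCircle)) {x y : X} (γ : Path x y) : ℝ :=
  (exists_circle_lift (f.comp γ.toContinuousMap)).choose 1 -
    (exists_circle_lift (f.comp γ.toContinuousMap)).choose 0

theorem winding_eq (f : C(X, UnitAddCircle)) {x y : X} (γ : Path x y) (θ : I → ℝ)
    (hθ : Continuous θ) (h : ∀ t, (θ t : UnitAddCircle) = f (γ t)) :
    winding f γ = θ 1 - θ 0 := by
  have hc := (exists_circle_lift (f.comp γ.toContinuousMap)).choose_spec
  set θ' := (exists_circle_lift (f.comp γ.toContinuousMap)).choose with hθ'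
  have : θ' 1 - θ 1 = θ' 0 - θ 0 := by
    refine eq_of_coe_unitAddCircle_eq_zero (S := univ) isPreconnected_univ
      (g := fun t => θ' t - θ t) (by fun_prop) (fun t _ => ?_) (mem_univ _) (mem_univ _)
    rw [AddCircle.coe_sub, hc, h, sub_eq_zero]
    rfl
  rw [winding, ← hθ']
  linarith

theorem exists_lift_path (f : C(X, UnitAddCircle)) {x y : X} (γ : Path x y) :
    ∃ θ : C(I, ℝ), ∀ t, (θ t : UnitAddCircle) = f (γ t) :=
  exists_circle_lift (f.comp γ.toContinuousMap)

theorem winding_trans (f : C(X, UnitAddCircle)) {x y z : X} (γ : Path x y) (γ' : Path y z) :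
    winding f (γ.trans γ') = winding f γ + winding f γ' := by
  obtain ⟨θ, hθ⟩ := exists_lift_path f (γ.trans γ')
  have h1 : winding f γ = θ ⟨1 / 2, by norm_num, by norm_num⟩ - θ 0 := by
    rw [winding_eq f γ (fun t => θ ⟨t / 2, by linarith [t.2.1], by linarith [t.2.2]⟩)]
    · congr 2
      all_goals ext; simp
    · fun_prop
    · intro t
      rw [hθ, Path.trans_apply, dif_pos (by simp; linarith [t.2.2])]
      congr 2
      ext
      simp
      ring
  have h2 : winding f γ' = θ 1 - θ ⟨1 / 2, by norm_num, by norm_num⟩ := by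
    rw [winding_eq f γ' (fun t => θ ⟨(1 + t) / 2, by linarith [t.2.1], by linarith [t.2.2]⟩)]
    · congr 2 <;> ext <;> simp
    · fun_prop
    · intro t
      rw [hθ, Path.trans_apply]
      split_ifs with ht
      · have ht0 : t = 0 := by
          refine Subtype.ext (le_antisymm ?_ t.2.1)
          simp at ht ⊢
          linarith
        subst ht0
        simp
      · congr 2
        ext
        simp
        ring
  rw [h1, h2, winding_eq f _ θ θ.continuous hθ]
  ring

theorem winding_symm (f : C(X, UnitAddCircle)) {x y : X} (γ : Path x y) :
    winding f γ.symm = -winding f γ := by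
  obtain ⟨θ, hθ⟩ := exists_lift_path f γ
  rw [winding_eq f γ θ θ.continuous hθ,
    winding_eq f γ.symm (fun t => θ (σ t)) (by fun_prop) (fun t => by rw [hθ]; rfl)]
  simp

/-- Monodromy: lifts of homotopic paths that start at the same point end at the same point. -/
theorem winding_congr (f : C(X, UnitAddCircle)) {x y : X} {γ γ' : Path x y}
    (h : γ.Homotopic γ') : winding f γ = winding f γ' := by
  obtain ⟨e, he⟩ := QuotientAddGroup.mk_surjective (f x)
  have cov := AddCircle.isCoveringMap_coe (1 : ℝ)
  have e0 : (f.comp γ.toContinuousMap) 0 = ((e : ℝ) : UnitAddCircle) := by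
    simpa using he.symm
  have e1 : (f.comp γ'.toContinuousMap) 0 = ((e : ℝ) : UnitAddCircle) := by
    simpa using he.symm
  have hrel : (f.comp γ.toContinuousMap).HomotopicRel (f.comp γ'.toContinuousMap) {0, 1} :=
    Path.Homotopic.map h f
  have := cov.liftPath_apply_one_eq_of_homotopicRel hrel e e0 e1
  rw [winding_eq f γ (cov.liftPath _ e e0) (ContinuousMap.continuous _)
      (fun t => congrFun (cov.liftPath_lifts _ e e0) t),
    winding_eq f γ' (cov.liftPath _ e e1) (ContinuousMap.continuous _)
      (fun t => congrFun (cov.liftPath_lifts _ e e1) t), this, cov.liftPath_zero,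
      cov.liftPath_zero]

/-! ### Classes of paths in the first homology group -/

variable [PathConnectedSpace X] (x₀ : X)

/-- The class of a path in the abelianized fundamental group, obtained by joining its ends to the
base point along fixed paths. -/
def h1Class {x y : X} (γ : Path x y) : Additive (Abelianization (FundamentalGroup X x₀)) :=
  Additive.ofMul (Abelianization.of (FundamentalGroup.fromPath (Path.Homotopic.Quotient.mk
    (((PathConnectedSpace.somePath x₀ x).trans γ).trans (PathConnectedSpace.somePath x₀ y).symm))))

theorem h1Class_congr {x y : X} {γ γ' : Path x y} (h : γ.Homotopic γ') :
    h1Class x₀ γ = h1Class x₀ γ' := by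
  simp only [h1Class, Path.Homotopic.Quotient.mk_trans, Path.Homotopic.Quotient.eq.2 h]

theorem h1Class_trans {x y z : X} (γ : Path x y) (γ' : Path y z) :
    h1Class x₀ (γ.trans γ') = h1Class x₀ γ + h1Class x₀ γ' := by
  -- The product in `FundamentalGroup` composes paths in the opposite order, hence the swap.
  rw [add_comm, h1Class, h1Class, h1Class, ← ofMul_mul, ← map_mul, FundamentalGroup.mul_def]
  congr 2
  simp only [Path.Homotopic.Quotient.mk_trans, Path.Homotopic.Quotient.mk_symm,
    Path.Homotopic.Quotient.trans_assoc]
  congr 2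
  rw [← Path.Homotopic.Quotient.trans_assoc (Path.Homotopic.Quotient.symm _),
    Path.Homotopic.Quotient.symm_trans, Path.Homotopic.Quotient.refl_trans]

theorem h1Class_cast {x y x' y' : X} (γ : Path x y) (hx : x' = x) (hy : y' = y) :
    h1Class x₀ (γ.cast hx hy) = h1Class x₀ γ := by
  subst hx hy; rfl

theorem h1Class_refl (x : X) : h1Class x₀ (Path.refl x) = 0 := by
  have := h1Class_trans x₀ (Path.refl x) (Path.refl x)
  rw [Path.refl_trans_refl] at this
  simpa using this

/-- Another choice of the joining path conjugates the class by the loop `g`, and conjugation is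
invisible in the abelianization. -/
theorem of_conj_loop {y : X} (γ : Path y y) (q : Path x₀ y) :
    Additive.ofMul (Abelianization.of (FundamentalGroup.fromPath (Path.Homotopic.Quotient.mk
      ((q.trans γ).trans q.symm)))) = h1Class x₀ γ := by
  set s := PathConnectedSpace.somePath x₀ y
  set g : FundamentalGroup X x₀ := FundamentalGroup.fromPath (Path.Homotopic.Quotient.mk
    (q.trans s.symm))
  set a : FundamentalGroup X x₀ := FundamentalGroup.fromPath (Path.Homotopic.Quotient.mk
    ((s.trans γ).trans s.symm))
  set g' : FundamentalGroup X x₀ := FundamentalGroup.fromPath (Path.Homotopic.Quotient.mk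
    (s.trans q.symm))
  have hg : g * g' = 1 := by
    rw [FundamentalGroup.mul_def, FundamentalGroup.one_def]
    simp only [g, g', Path.Homotopic.Quotient.mk_trans, Path.Homotopic.Quotient.mk_symm,
      Path.Homotopic.Quotient.trans_assoc]
    rw [← Path.Homotopic.Quotient.trans_assoc (Path.Homotopic.Quotient.symm _),
      Path.Homotopic.Quotient.symm_trans, Path.Homotopic.Quotient.refl_trans,
      Path.Homotopic.Quotient.trans_symm]
  have hconj : (FundamentalGroup.fromPath (Path.Homotopic.Quotient.mk
      ((q.trans γ).trans q.symm)) : FundamentalGroup X x₀) = g' * (a * g) := by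
    rw [FundamentalGroup.mul_def, FundamentalGroup.mul_def]
    simp only [g, g', a, Path.Homotopic.Quotient.mk_trans, Path.Homotopic.Quotient.mk_symm,
      Path.Homotopic.Quotient.trans_assoc]
    rw [← Path.Homotopic.Quotient.trans_assoc (Path.Homotopic.Quotient.symm _) _
        (Path.Homotopic.Quotient.symm (Path.Homotopic.Quotient.mk q)),
      Path.Homotopic.Quotient.symm_trans, Path.Homotopic.Quotient.refl_trans,
      ← Path.Homotopic.Quotient.trans_assoc (Path.Homotopic.Quotient.symm _)
        (Path.Homotopic.Quotient.mk s),
      Path.Homotopic.Quotient.symm_trans, Path.Homotopic.Quotient.refl_trans]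
  have hab : Abelianization.of (g' * (a * g)) = Abelianization.of a := by
    rw [map_mul, mul_comm, map_mul, mul_assoc, ← map_mul Abelianization.of g, hg, map_one, mul_one]
  rw [hconj, hab]
  rfl

/-- The homomorphism on the first homology group given by the winding number. -/
theorem exists_winding_hom (f : C(X, UnitAddCircle)) :
    ∃ w : Additive (Abelianization (FundamentalGroup X x₀)) →+ ℝ,
      ∀ (y : X) (γ : Path y y), w (h1Class x₀ γ) = winding f γ := by
  let w₀ : FundamentalGroup X x₀ → ℝ := fun g =>
    Quotient.lift (fun γ : Path x₀ x₀ => winding f γ) (fun _ _ h => winding_congr f h) g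
  have hw₀ : ∀ γ : Path x₀ x₀, w₀ (FundamentalGroup.fromPath (Path.Homotopic.Quotient.mk γ)) =
    winding f γ := fun γ => rfl
  let w₁ : FundamentalGroup X x₀ →* Multiplicative ℝ := MonoidHom.mk'
    (fun g => Multiplicative.ofAdd (w₀ g)) (by
      intro a b
      induction a using Path.Homotopic.Quotient.ind with | mk a =>
      induction b using Path.Homotopic.Quotient.ind with | mk b =>
      rw [← ofAdd_add, FundamentalGroup.mul_def, ← Path.Homotopic.Quotient.mk_trans]
      congr 1
      exact (winding_trans f b a).trans (add_comm _ _))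
  refine ⟨(Abelianization.lift w₁).toAdditiveLeft, fun y γ => ?_⟩
  have : winding f (((PathConnectedSpace.somePath x₀ y).trans γ).trans
      (PathConnectedSpace.somePath x₀ y).symm) = winding f γ := by
    rw [winding_trans, winding_trans, winding_symm]; ring
  rw [← this]
  rfl

/-! ### Generators of a free abelian group -/

/-- A generating family of a free abelian group whose size is the rank is a basis; the homomorphisms
are its coordinates. -/
theorem exists_dual_of_closure_eq_top {A : Type*} [AddCommGroup A] {m : ℕ}
    (e : A ≃+ (Fin m →₀ ℤ)) (v : Fin m → A) (hv : AddSubgroup.closure (range v) = ⊤) :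
    (∃ l : Fin m → A →+ ℤ, ∀ i j, l i (v j) = if i = j then 1 else 0) ∧
      ∀ a, ∃ z : Fin m → ℤ, a = ∑ j, z j • v j := by
  have hspan : ⊤ ≤ Submodule.span ℤ (range v) := by
    intro a _
    rw [← Submodule.mem_toAddSubgroup, Submodule.span_int_eq_addSubgroupClosure, hv]
    trivial
  have hcard : Fintype.card (Fin m) = Module.finrank ℤ A := by
    rw [e.toIntLinearEquiv.finrank_eq]; simp
  have : Module.Free ℤ A := Module.Free.of_equiv e.toIntLinearEquiv.symm
  let b := basisOfTopLeSpanOfCardEqFinrank v hspan hcard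
  have hb : ∀ j, b j = v j := fun j => by simp [b]
  refine ⟨⟨fun i => (b.coord i).toAddMonoidHom, fun i j => ?_⟩, fun a => ⟨fun j => b.repr a j, ?_⟩⟩
  · rw [← hb]
    simp [Finsupp.single_apply, eq_comm]
  · conv_lhs => rw [← b.sum_repr a]
    simp [hb]

end MomentsCurve
end

noncomputable section
namespace MomentsCurve

/-! ### Circle valued coordinates of the arcs of a triangulation -/

variable {n k : ℕ}

open Classical in
/-- The map to the circle that wraps the arc parametrized by `h` around the circle and sends all
points off this arc to `0`. -/
def arcCoord (h : ℝ → Fin n → ℝ) (x : Fin n → ℝ) : UnitAddCircle :=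
  if x ∈ arc h then (Function.invFunOn h (Icc 0 1) x : ℝ) else 0

theorem arcCoord_of_notMem {h : ℝ → Fin n → ℝ} {x : Fin n → ℝ} (hx : x ∉ arc h) :
    arcCoord h x = 0 := if_neg hx

theorem mem_arc (h : ℝ → Fin n → ℝ) {t : ℝ} (ht : t ∈ Icc (0 : ℝ) 1) : h t ∈ arc h :=
  mem_image_of_mem h ht

theorem IsLipschitzArc.invFunOn_apply {h : ℝ → Fin n → ℝ} (hh : IsLipschitzArc h) {t : ℝ}
    (ht : t ∈ Icc (0 : ℝ) 1) : Function.invFunOn h (Icc 0 1) (h t) = t :=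
  hh.injective.leftInvOn_invFunOn ht

theorem IsLipschitzArc.arcCoord_apply {h : ℝ → Fin n → ℝ} (hh : IsLipschitzArc h) {t : ℝ}
    (ht : t ∈ Icc (0 : ℝ) 1) : arcCoord h (h t) = (t : UnitAddCircle) := by
  rw [arcCoord, if_pos (mem_arc h ht), hh.invFunOn_apply ht]

theorem IsLipschitzArc.continuousOn {h : ℝ → Fin n → ℝ} (hh : IsLipschitzArc h) :
    ContinuousOn h (Icc 0 1) := by
  obtain ⟨K, hK⟩ := hh.lipschitz
  exact hK.continuousOn

theorem IsLipschitzArc.isCompact {h : ℝ → Fin n → ℝ} (hh : IsLipschitzArc h) :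
    IsCompact (arc h) := isCompact_Icc.image_of_continuousOn hh.continuousOn

theorem IsLipschitzArc.continuousOn_invFunOn {h : ℝ → Fin n → ℝ} (hh : IsLipschitzArc h) :
    ContinuousOn (Function.invFunOn h (Icc 0 1)) (arc h) := by
  rw [continuousOn_iff_isClosed]
  intro t ht
  refine ⟨h '' (Icc 0 1 ∩ t), ?_, ?_⟩
  · exact ((isCompact_Icc.inter_right ht).image_of_continuousOn
      (hh.continuousOn.mono inter_subset_left)).isClosed
  · ext x
    constructor
    · rintro ⟨hx, y, hy, rfl⟩
      refine ⟨⟨y, ⟨hy, ?_⟩, rfl⟩, mem_image_of_mem h hy⟩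
      rwa [mem_preimage, hh.invFunOn_apply hy] at hx
    · rintro ⟨⟨y, ⟨hy, hyt⟩, rfl⟩, hx⟩
      refine ⟨?_, hx⟩
      rwa [mem_preimage, hh.invFunOn_apply hy]

theorem IsLipschitzArc.arcCoord_zero {h : ℝ → Fin n → ℝ} (hh : IsLipschitzArc h) :
    arcCoord h (h 0) = 0 := by
  rw [hh.arcCoord_apply (by simp)]; simp

theorem IsLipschitzArc.arcCoord_one {h : ℝ → Fin n → ℝ} (hh : IsLipschitzArc h) :
    arcCoord h (h 1) = 0 := by
  rw [hh.arcCoord_apply (by simp)]; simp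

theorem IsLipschitzArc.arcCoord_ends {h : ℝ → Fin n → ℝ} (hh : IsLipschitzArc h)
    {x : Fin n → ℝ} (hx : x ∈ ({h 0, h 1} : Set (Fin n → ℝ))) : arcCoord h x = 0 := by
  rcases hx with rfl | rfl
  · exact hh.arcCoord_zero
  · exact hh.arcCoord_one

theorem IsLipschitzArc.continuousOn_arcCoord {h : ℝ → Fin n → ℝ} (hh : IsLipschitzArc h) :
    ContinuousOn (arcCoord h) (arc h) := by
  refine ContinuousOn.congr (f := fun x => ((Function.invFunOn h (Icc 0 1) x : ℝ) : UnitAddCircle))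
    ((AddCircle.continuous_mk' 1).comp_continuousOn hh.continuousOn_invFunOn)
    (fun x hx => by rw [arcCoord, if_pos hx])

/-! ### Arc coordinates and vertices of a triangulated set -/

variable {C : Set (Fin n → ℝ)} {h : Fin k → ℝ → Fin n → ℝ}

namespace IsLipschitzTriangulation

variable (hT : IsLipschitzTriangulation C h)
include hT

theorem arc_subset (i : Fin k) : arc (h i) ⊆ C := by
  rw [← hT.union]; exact subset_iUnion (fun i => arc (h i)) i

theorem arcCoord_eq_zero_of_mem {i j : Fin k} (hij : i ≠ j) {x : Fin n → ℝ}
    (hx : x ∈ arc (h j)) : arcCoord (h i) x = 0 := by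
  by_cases hxi : x ∈ arc (h i)
  · exact (hT.isArc i).arcCoord_ends (hT.endpoints i j hij ⟨hxi, hx⟩).1
  · exact arcCoord_of_notMem hxi

/-- Gluing over a finite closed cover: the coordinate vanishes on every other arc, since two arcs
meet only in endpoints and both endpoints go to `0` on the circle. -/
theorem continuousOn_arcCoord (i : Fin k) : ContinuousOn (arcCoord (h i)) C := by
  rw [← hT.union]
  refine (locallyFinite_of_finite _).continuousOn_iUnion
    (fun j => (hT.isArc j).isCompact.isClosed) (fun j => ?_)
  by_cases hij : i = j
  · subst hij; exact (hT.isArc i).continuousOn_arcCoord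
  · exact continuousOn_const.congr fun x hx => hT.arcCoord_eq_zero_of_mem hij hx

end IsLipschitzTriangulation

/-- The vertices of a triangulation. -/
def vertices (h : Fin k → ℝ → Fin n → ℝ) : Set (Fin n → ℝ) :=
  ⋃ i, {h i 0, h i 1}

theorem finite_vertices (h : Fin k → ℝ → Fin n → ℝ) : (vertices h).Finite :=
  finite_iUnion fun _ => by simp

theorem start_mem_vertices (h : Fin k → ℝ → Fin n → ℝ) (i : Fin k) : h i 0 ∈ vertices h :=
  mem_iUnion.2 ⟨i, by simp⟩

theorem end_mem_vertices (h : Fin k → ℝ → Fin n → ℝ) (i : Fin k) : h i 1 ∈ vertices h :=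
  mem_iUnion.2 ⟨i, by simp⟩

namespace IsLipschitzTriangulation

variable (hT : IsLipschitzTriangulation C h)
include hT

theorem arcCoord_vertex (i : Fin k) {x : Fin n → ℝ} (hx : x ∈ vertices h) :
    arcCoord (h i) x = 0 := by
  obtain ⟨j, hj⟩ := mem_iUnion.1 hx
  by_cases hij : i = j
  · subst hij; exact (hT.isArc i).arcCoord_ends hj
  · refine hT.arcCoord_eq_zero_of_mem hij ?_
    rcases hj with rfl | rfl
    · exact mem_image_of_mem _ (by simp)
    · exact mem_image_of_mem _ (by simp)

theorem exists_arc {x : Fin n → ℝ} (hx : x ∈ C) : ∃ i, ∃ t ∈ Icc (0 : ℝ) 1, h i t = x := by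
  rw [← hT.union] at hx
  obtain ⟨i, t, ht, rfl⟩ := mem_iUnion.1 hx
  exact ⟨i, t, ht, rfl⟩

theorem exists_arc_of_notMem_vertices {x : Fin n → ℝ} (hx : x ∈ C) (hv : x ∉ vertices h) :
    ∃ i, ∃ t ∈ Ioo (0 : ℝ) 1, h i t = x := by
  obtain ⟨i, t, ht, rfl⟩ := hT.exists_arc hx
  refine ⟨i, t, ⟨lt_of_le_of_ne ht.1 ?_, lt_of_le_of_ne ht.2 ?_⟩, rfl⟩
  · rintro rfl; exact hv (start_mem_vertices h i)
  · rintro rfl; exact hv (end_mem_vertices h i)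

theorem notMem_vertices {i : Fin k} {t : ℝ} (ht : t ∈ Ioo (0 : ℝ) 1) : h i t ∉ vertices h := by
  intro hv
  have h0 := hT.arcCoord_vertex i hv
  rw [(hT.isArc i).arcCoord_apply (Ioo_subset_Icc_self ht)] at h0
  obtain ⟨m, hm⟩ := exists_int_of_coe_eq_zero h0
  have h1 : (0 : ℝ) < m := hm ▸ ht.1
  have h2 : (m : ℝ) < 1 := hm ▸ ht.2
  have h1' : 0 < m := by exact_mod_cast h1
  have h2' : m < 1 := by exact_mod_cast h2
  omega

theorem notMem_arc {i j : Fin k} (hij : i ≠ j) {t : ℝ} (ht : t ∈ Ioo (0 : ℝ) 1) :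
    h i t ∉ arc (h j) := by
  intro hx
  have := (hT.endpoints i j hij ⟨mem_image_of_mem _ (Ioo_subset_Icc_self ht), hx⟩).1
  exact hT.notMem_vertices ht (mem_iUnion.2 ⟨i, this⟩)

/-- Near a point of the interior of an arc, the set `C` coincides with this arc. -/
theorem eventually_mem_arc {i : Fin k} {t : ℝ} (ht : t ∈ Ioo (0 : ℝ) 1) :
    ∀ᶠ x in 𝓝[C] (h i t), x ∈ arc (h i) := by
  have hcl : IsClosed (⋃ j : {j // j ≠ i}, arc (h j)) :=
    isClosed_iUnion_of_finite fun j => (hT.isArc j).isCompact.isClosed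
  have hnm : h i t ∉ ⋃ j : {j // j ≠ i}, arc (h j) := by
    simp only [mem_iUnion, not_exists]
    exact fun j => hT.notMem_arc j.2.symm ht
  filter_upwards [self_mem_nhdsWithin, mem_nhdsWithin_of_mem_nhds (hcl.isOpen_compl.mem_nhds hnm)]
    with x hxC hx
  obtain ⟨j, s, hs, rfl⟩ := hT.exists_arc hxC
  by_cases hij : j = i
  · subst hij; exact mem_image_of_mem _ hs
  · exact absurd (mem_iUnion.2 ⟨⟨j, hij⟩, mem_arc (h j) hs⟩) hx

end IsLipschitzTriangulation

end MomentsCurve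
end

noncomputable section
namespace MomentsCurve

/-! ### Line integrals along Lipschitz maps -/

variable {n k : ℕ}

/-- The integral of the form `P dx_s` along `g` over `[a,b]`. -/
def lineIntegral (P : (Fin n → ℝ) → ℝ) (s : Fin n) (g : ℝ → Fin n → ℝ) (a b : ℝ) : ℝ :=
  ∫ t in a..b, P (g t) * deriv (fun u => g u s) t

theorem lipschitzOnWith_coord {K : NNReal} {g : ℝ → Fin n → ℝ} {S : Set ℝ}
    (hg : LipschitzOnWith K g S) (s : Fin n) : LipschitzOnWith K (fun u => g u s) S := by
  have := (LipschitzWith.eval (α := fun _ : Fin n => ℝ) s).comp_lipschitzOnWith hg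
  rw [one_mul] at this
  exact this

theorem abs_deriv_coord_le {K : NNReal} {g : ℝ → Fin n → ℝ} {a b : ℝ}
    (hg : LipschitzOnWith K g (Icc a b)) (s : Fin n) {t : ℝ} (ht : t ∈ Ioo a b) :
    |deriv (fun u => g u s) t| ≤ K :=
  norm_deriv_le_of_lipschitzOn (Icc_mem_nhds ht.1 ht.2) (lipschitzOnWith_coord hg s)

theorem intervalIntegrable_deriv_coord {K : NNReal} {g : ℝ → Fin n → ℝ} {a b : ℝ}
    (hg : LipschitzOnWith K g (Icc a b)) (s : Fin n) {x y : ℝ} (hx : x ∈ Icc a b)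
    (hy : y ∈ Icc a b) : IntervalIntegrable (deriv (fun u => g u s)) volume x y :=
  (((lipschitzOnWith_coord hg s).mono
    (uIcc_subset_Icc hx hy)).absolutelyContinuousOnInterval).intervalIntegrable_deriv

theorem integral_deriv_coord {K : NNReal} {g : ℝ → Fin n → ℝ} {a b : ℝ}
    (hg : LipschitzOnWith K g (Icc a b)) (s : Fin n) {x y : ℝ} (hx : x ∈ Icc a b)
    (hy : y ∈ Icc a b) : ∫ t in x..y, deriv (fun u => g u s) t = g y s - g x s :=
  (((lipschitzOnWith_coord hg s).mono
    (uIcc_subset_Icc hx hy)).absolutelyContinuousOnInterval).integral_deriv_eq_sub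

theorem intervalIntegrable_form {K : NNReal} {g : ℝ → Fin n → ℝ} {a b : ℝ}
    (hg : LipschitzOnWith K g (Icc a b)) (s : Fin n) {P : (Fin n → ℝ) → ℝ} (hP : Continuous P)
    {x y : ℝ} (hx : x ∈ Icc a b) (hy : y ∈ Icc a b) :
    IntervalIntegrable (fun t => P (g t) * deriv (fun u => g u s) t) volume x y :=
  (intervalIntegrable_deriv_coord hg s hx hy).continuousOn_mul
    (hP.comp_continuousOn (hg.continuousOn.mono (uIcc_subset_Icc hx hy)))

/-- First order expansion of the integral for small increments. It replaces a chain rule: neither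
curves nor arcs need be differentiable at a given point. -/
theorem abs_lineIntegral_sub_le {K : NNReal} {g : ℝ → Fin n → ℝ} {a b : ℝ}
    (hg : LipschitzOnWith K g (Icc a b)) (s : Fin n) {P : (Fin n → ℝ) → ℝ} (hP : Continuous P)
    {x y : ℝ} (hx : x ∈ Icc a b) (hy : y ∈ Icc a b) {c ε : ℝ}
    (hc : ∀ u ∈ uIcc x y, |P (g u) - c| ≤ ε) :
    |lineIntegral P s g x y - c * (g y s - g x s)| ≤ ε * K * |y - x| := by
  have h1 : lineIntegral P s g x y - c * (g y s - g x s) =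
      ∫ t in x..y, (P (g t) - c) * deriv (fun u => g u s) t := by
    rw [lineIntegral, ← integral_deriv_coord hg s hx hy, ← intervalIntegral.integral_const_mul,
      ← intervalIntegral.integral_sub (intervalIntegrable_form hg s hP hx hy)
        ((intervalIntegrable_deriv_coord hg s hx hy).const_mul c)]
    simp only [sub_mul]
  rw [h1, ← Real.norm_eq_abs]
  refine intervalIntegral.norm_integral_le_of_norm_le_const_ae ?_
  have hb : ∀ᵐ t : ℝ, t ≠ b := by simp [ae_iff]
  filter_upwards [hb] with t htb ht
  have htI : t ∈ uIcc x y := uIoc_subset_uIcc ht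
  have ht1 : t ∈ Ioo a b := by
    refine ⟨?_, lt_of_le_of_ne (uIcc_subset_Icc hx hy htI).2 htb⟩
    rw [mem_uIoc] at ht
    rcases ht with ht | ht
    · exact hx.1.trans_lt ht.1
    · exact hy.1.trans_lt ht.1
  rw [norm_mul]
  exact mul_le_mul (hc t htI) (abs_deriv_coord_le hg s ht1) (abs_nonneg _)
    ((abs_nonneg _).trans (hc t htI))

theorem lineIntegral_add {K : NNReal} {g : ℝ → Fin n → ℝ} {a b : ℝ}
    (hg : LipschitzOnWith K g (Icc a b)) (s : Fin n) {P : (Fin n → ℝ) → ℝ} (hP : Continuous P)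
    {x y z : ℝ} (hx : x ∈ Icc a b) (hy : y ∈ Icc a b) (hz : z ∈ Icc a b) :
    lineIntegral P s g x y + lineIntegral P s g y z = lineIntegral P s g x z :=
  intervalIntegral.integral_add_adjacent_intervals (intervalIntegrable_form hg s hP hx hy)
    (intervalIntegrable_form hg s hP hy hz)

theorem continuousOn_lineIntegral {K : NNReal} {g : ℝ → Fin n → ℝ}
    (hg : LipschitzOnWith K g (Icc 0 1)) (s : Fin n) {P : (Fin n → ℝ) → ℝ} (hP : Continuous P) :
    ContinuousOn (lineIntegral P s g 0) (Icc 0 1) := by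
  have := intervalIntegral.continuousOn_primitive_interval (a := (0 : ℝ)) (b := 1) (μ := volume)
    (f := fun t => P (g t) * deriv (fun u => g u s) t)
    ((intervalIntegrable_iff_integrableOn_Icc_of_le zero_le_one).1
      (intervalIntegrable_form hg s hP (by simp) (by simp)) |> fun h => by
        rwa [uIcc_of_le zero_le_one])
  rwa [uIcc_of_le zero_le_one] at this

/-- The primitive of a form along an arc, extended quasi-periodically to the real line. -/
def quasiPrimitive (P : (Fin n → ℝ) → ℝ) (s : Fin n) (h : ℝ → Fin n → ℝ) (x : ℝ) : ℝ :=
  ∫ t in (0 : ℝ)..x, P (h (Int.fract t)) * deriv (fun u => h u s) (Int.fract t)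

section quasiPrimitive

variable {K : NNReal} {h : ℝ → Fin n → ℝ} (hh : LipschitzOnWith K h (Icc 0 1)) (s : Fin n)
  {P : (Fin n → ℝ) → ℝ} (hP : Continuous P)

theorem periodic_quasi_integrand (P : (Fin n → ℝ) → ℝ) (s : Fin n) (h : ℝ → Fin n → ℝ) :
    Function.Periodic
      (fun t => P (h (Int.fract t)) * deriv (fun u => h u s) (Int.fract t)) 1 := by
  intro t
  simp only [Int.fract_add_one]

theorem ae_fract_eq_self {x : ℝ} (hx : x ∈ Icc (0 : ℝ) 1) (f : ℝ → ℝ) :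
    ∀ᵐ t : ℝ, t ∈ uIoc 0 x → f (Int.fract t) = f t := by
  have hb : ∀ᵐ t : ℝ, t ≠ 1 := by simp [ae_iff]
  filter_upwards [hb] with t ht1 ht
  rw [uIoc_of_le hx.1] at ht
  rw [Int.fract_eq_self.2 ⟨ht.1.le, lt_of_le_of_ne (ht.2.trans hx.2) ht1⟩]

theorem quasiPrimitive_eq (P : (Fin n → ℝ) → ℝ) (s : Fin n) (h : ℝ → Fin n → ℝ) {x : ℝ}
    (hx : x ∈ Icc (0 : ℝ) 1) : quasiPrimitive P s h x = lineIntegral P s h 0 x :=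
  intervalIntegral.integral_congr_ae
    (ae_fract_eq_self hx fun t => P (h t) * deriv (fun u => h u s) t)

include hh hP in
theorem intervalIntegrable_quasi (a b : ℝ) : IntervalIntegrable
    (fun t => P (h (Int.fract t)) * deriv (fun u => h u s) (Int.fract t)) volume a b := by
  refine (periodic_quasi_integrand P s h).intervalIntegrable₀ one_ne_zero ?_ a b
  refine (intervalIntegrable_form hh s hP (x := 0) (y := 1) (by simp) (by simp)).congr_ae ?_
  rw [Filter.EventuallyEq, ae_restrict_iff' measurableSet_uIoc]
  filter_upwards [ae_fract_eq_self (x := 1) (by simp)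
    fun t => P (h t) * deriv (fun u => h u s) t] with t ht htm
  exact (ht htm).symm

include hh hP in
theorem continuous_quasiPrimitive : Continuous (quasiPrimitive P s h) :=
  intervalIntegral.continuous_primitive (intervalIntegrable_quasi hh s hP) 0

include hh hP in
-- An integer shift adds full traversals of the arc. Thus the primitive can be composed with a real
-- lift of the arc coordinate.
theorem quasiPrimitive_add_int (x : ℝ) (m : ℤ) :
    quasiPrimitive P s h (x + m) = quasiPrimitive P s h x + m * quasiPrimitive P s h 1 := by
  have h1 := (periodic_quasi_integrand P s h).intervalIntegral_add_zsmul_eq m x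
    (intervalIntegrable_quasi hh s hP)
  have h2 := intervalIntegral.integral_add_adjacent_intervals
    (intervalIntegrable_quasi hh s hP 0 x) (intervalIntegrable_quasi hh s hP x (x + m))
  rw [quasiPrimitive, ← h2]
  simp only [zsmul_eq_mul, mul_one] at h1
  rw [h1, (periodic_quasi_integrand P s h).intervalIntegral_add_eq x 0, zero_add]
  rfl

end quasiPrimitive

/-! ### A function whose derivative vanishes off a closed set and along this set is constant -/

theorem eq_of_hasDerivWithinAt_zero_of_notMem {W : ℝ → ℝ} {Z : Set ℝ}
    (hW : ContinuousOn W (Icc 0 1))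
    (h1 : ∀ t ∈ Icc (0 : ℝ) 1, t ∉ Z → HasDerivWithinAt W 0 (Icc 0 1) t)
    {x y : ℝ} (hx : x ∈ Icc (0 : ℝ) 1) (hy : y ∈ Icc (0 : ℝ) 1) (hxy : x < y)
    (hZ : ∀ t ∈ Ioo x y, t ∉ Z) : W x = W y := by
  obtain ⟨c, -, hc⟩ := exists_hasDerivAt_eq_slope W (fun _ => 0) hxy
    (hW.mono (Icc_subset_Icc hx.1 hy.2)) (fun t ht =>
      (h1 t ⟨hx.1.trans ht.1.le, ht.2.le.trans hy.2⟩ (hZ t ht)).hasDerivAt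
        (Icc_mem_nhds (hx.1.trans_lt ht.1) (ht.2.trans_le hy.2)))
  rw [eq_comm, div_eq_zero_iff] at hc
  rcases hc with hc | hc <;> linarith

theorem eq_of_hasDerivWithinAt_zero_of_closed {W : ℝ → ℝ} {Z : Set ℝ}
    (hW : ContinuousOn W (Icc 0 1)) (hZ : IsClosed (Z ∩ Icc 0 1))
    (h1 : ∀ t ∈ Icc (0 : ℝ) 1, t ∉ Z → HasDerivWithinAt W 0 (Icc 0 1) t)
    (h2 : ∀ t ∈ Z ∩ Icc 0 1, ∀ ε > 0, ∃ δ > 0, ∀ t' ∈ Z ∩ Icc 0 1, |t' - t| < δ →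
      |W t' - W t| ≤ ε * |t' - t|) : W 1 = W 0 := by
  have key : ∀ t ∈ Icc (0 : ℝ) 1, HasDerivWithinAt W 0 (Icc 0 1) t := by
    intro t ht
    by_cases htZ : t ∈ Z
    swap
    · exact h1 t ht htZ
    rw [hasDerivWithinAt_iff_isLittleO, Asymptotics.isLittleO_iff]
    intro ε hε
    obtain ⟨δ, hδ, hδ'⟩ := h2 t ⟨htZ, ht⟩ ε hε
    filter_upwards [self_mem_nhdsWithin, mem_nhdsWithin_of_mem_nhds (Metric.ball_mem_nhds t hδ)]
      with t' ht' hb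
    rw [Metric.mem_ball, Real.dist_eq] at hb
    simp only [smul_eq_mul, mul_zero, sub_zero, Real.norm_eq_abs]
    have hcpt : ∀ x y, IsCompact ((Z ∩ Icc 0 1) ∩ Icc x y) := fun x y =>
      isCompact_Icc.inter_left hZ
    -- Let `t₁` be the point of `Z` between `t` and `t'` that is nearest to `t'`. As `W` is constant
    -- between `t₁` and `t'`, the estimate along `Z` at `t₁` controls `W t'`.
    rcases lt_trichotomy t t' with hlt | rfl | hlt
    · obtain ⟨t₁, ⟨⟨ht₁, ht₁'⟩, htt⟩, hmax⟩ := (hcpt t t').exists_isGreatest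
        ⟨t, ⟨htZ, ht⟩, left_mem_Icc.2 hlt.le⟩
      have hle : |t₁ - t| ≤ |t' - t| := by
        rw [abs_of_nonneg (by linarith [htt.1]), abs_of_nonneg (by linarith)]
        linarith [htt.2]
      have hW1 : W t₁ = W t' := by
        rcases htt.2.eq_or_lt with he | hlt'
        · rw [he]
        · refine eq_of_hasDerivWithinAt_zero_of_notMem hW h1 ht₁' ht' hlt' fun u hu huZ => ?_
          have := hmax ⟨⟨huZ, ht₁'.1.trans hu.1.le, hu.2.le.trans ht'.2⟩,
            htt.1.trans hu.1.le, hu.2.le⟩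
          exact absurd hu.1 (not_lt.2 this)
      rw [← hW1]
      exact (hδ' t₁ ⟨ht₁, ht₁'⟩ (hle.trans_lt hb)).trans (mul_le_mul_of_nonneg_left hle hε.le)
    · simp
    · obtain ⟨t₁, ⟨⟨ht₁, ht₁'⟩, htt⟩, hmin⟩ := (hcpt t' t).exists_isLeast
        ⟨t, ⟨htZ, ht⟩, right_mem_Icc.2 hlt.le⟩
      have hle : |t₁ - t| ≤ |t' - t| := by
        rw [abs_of_nonpos (by linarith [htt.2]), abs_of_nonpos (by linarith)]
        linarith [htt.1]
      have hW1 : W t' = W t₁ := by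
        rcases htt.1.eq_or_lt with he | hlt'
        · rw [he]
        · refine eq_of_hasDerivWithinAt_zero_of_notMem hW h1 ht' ht₁' hlt' fun u hu huZ => ?_
          have := hmin ⟨⟨huZ, ht'.1.trans hu.1.le, hu.2.le.trans ht₁'.2⟩,
            hu.1.le, hu.2.le.trans htt.2⟩
          exact absurd hu.2 (not_lt.2 this)
      rw [hW1]
      exact (hδ' t₁ ⟨ht₁, ht₁'⟩ (hle.trans_lt hb)).trans (mul_le_mul_of_nonneg_left hle hε.le)
  exact (eq_of_hasDerivWithinAt_zero_of_notMem (Z := ∅) hW (fun t ht _ => key t ht) (by simp)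
    (by simp) zero_lt_one (fun _ _ h => h)).symm

/-! ### The line integral over a closed curve in terms of winding numbers -/

theorem eventually_eq_of_coe_eq_zero {α : Type*} [TopologicalSpace α] {S : Set α} {g : α → ℝ}
    {t : α} (hg : ContinuousWithinAt g S t) (ht : t ∈ S)
    (h0 : ∀ᶠ u in 𝓝[S] t, (g u : UnitAddCircle) = 0) : ∀ᶠ u in 𝓝[S] t, g u = g t := by
  obtain ⟨m, hm⟩ := exists_int_of_coe_eq_zero (h0.self_of_nhdsWithin ht)
  filter_upwards [h0, hg (Metric.ball_mem_nhds (g t) one_pos)] with u hu hb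
  obtain ⟨l, hl⟩ := exists_int_of_coe_eq_zero hu
  rw [mem_preimage, Metric.mem_ball, Real.dist_eq, hm, hl] at hb
  rw [hl, hm]
  have : |l - m| < 1 := by exact_mod_cast hb
  rw [Int.abs_lt_one_iff, sub_eq_zero] at this
  rw [this]

variable {C : Set (Fin n → ℝ)} {h : Fin k → ℝ → Fin n → ℝ}

namespace IsLipschitzTriangulation

variable (hT : IsLipschitzTriangulation C h)
include hT

/-- Off the vertices, a lift of the coordinate of the arc that contains the curve follows the
parameter of the arc. -/
theorem eventually_lift_sub {G : ℝ → Fin n → ℝ} {S : Set ℝ} (hG : ContinuousOn G S)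
    (hGC : MapsTo G S C) {i : Fin k} {θ : ℝ → ℝ} (hθ : ContinuousOn θ S)
    (hθG : ∀ t ∈ S, (θ t : UnitAddCircle) = arcCoord (h i) (G t)) {t : ℝ} (ht : t ∈ S) {τ₀ : ℝ}
    (hτ₀ : τ₀ ∈ Ioo (0 : ℝ) 1) (hτG : h i τ₀ = G t) :
    ∃ (m : ℤ) (τ : ℝ → ℝ), τ t = τ₀ ∧ ContinuousWithinAt τ S t ∧
      ∀ᶠ u in 𝓝[S] t, τ u ∈ Icc (0 : ℝ) 1 ∧ h i (τ u) = G u ∧ θ u = τ u + m := by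
  set inv := Function.invFunOn (h i) (Icc 0 1) with hinv
  have hτ₀' := Ioo_subset_Icc_self hτ₀
  have hev : ∀ᶠ u in 𝓝[S] t, G u ∈ arc (h i) := by
    have := hT.eventually_mem_arc (i := i) hτ₀
    rw [hτG] at this
    exact ((hG t ht).tendsto_nhdsWithin hGC).eventually this
  have hinvG : ∀ u, G u ∈ arc (h i) → inv (G u) ∈ Icc (0 : ℝ) 1 ∧ h i (inv (G u)) = G u :=
    fun u hu => ⟨Function.invFunOn_mem hu, Function.invFunOn_eq hu⟩
  have hinvt : inv (G t) = τ₀ := by rw [← hτG, hinv, (hT.isArc i).invFunOn_apply hτ₀']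
  have hcont : ContinuousWithinAt (fun u => inv (G u)) S t := by
    have h1 : ContinuousWithinAt inv (arc (h i)) (G t) :=
      (hT.isArc i).continuousOn_invFunOn (G t) (hev.self_of_nhdsWithin ht)
    have h2 : Filter.Tendsto G (𝓝[S] t) (𝓝[arc (h i)] (G t)) :=
      tendsto_nhdsWithin_iff.2 ⟨hG t ht, hev⟩
    exact h1.tendsto.comp h2
  have hz : ∀ᶠ u in 𝓝[S] t, ((θ u - inv (G u) : ℝ) : UnitAddCircle) = 0 := by
    filter_upwards [hev, self_mem_nhdsWithin] with u hu huS
    rw [AddCircle.coe_sub, hθG u huS, sub_eq_zero]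
    nth_rw 1 [← (hinvG u hu).2]
    exact (hT.isArc i).arcCoord_apply (hinvG u hu).1
  obtain ⟨m, hm⟩ := exists_int_of_coe_eq_zero (hz.self_of_nhdsWithin ht)
  refine ⟨m, fun u => inv (G u), hinvt, hcont, ?_⟩
  filter_upwards [hev, eventually_eq_of_coe_eq_zero ((hθ t ht).sub hcont) ht hz] with u hu huz
  refine ⟨(hinvG u hu).1, (hinvG u hu).2, ?_⟩
  rw [Pi.sub_apply, Pi.sub_apply, hm] at huz
  linarith

theorem eventually_lift_eq {G : ℝ → Fin n → ℝ} {S : Set ℝ} (hG : ContinuousOn G S)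
    (hGC : MapsTo G S C) {i j : Fin k} (hij : j ≠ i) {θ : ℝ → ℝ} (hθ : ContinuousOn θ S)
    (hθG : ∀ t ∈ S, (θ t : UnitAddCircle) = arcCoord (h j) (G t)) {t : ℝ} (ht : t ∈ S) {τ₀ : ℝ}
    (hτ₀ : τ₀ ∈ Ioo (0 : ℝ) 1) (hτG : h i τ₀ = G t) :
    ∀ᶠ u in 𝓝[S] t, θ u = θ t := by
  refine eventually_eq_of_coe_eq_zero (hθ t ht) ht ?_
  have := hT.eventually_mem_arc (i := i) hτ₀
  rw [hτG] at this
  filter_upwards [((hG t ht).tendsto_nhdsWithin hGC).eventually this, self_mem_nhdsWithin]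
    with u hu huS
  rw [hθG u huS]
  exact hT.arcCoord_eq_zero_of_mem hij hu

/-- Compare the integral up to time `t` with `U`, the sum of the quasi-periodic primitives at the
lifts `θ i t`; the difference `W` has derivative zero. The inverses of the arcs are Lipschitz only
away from the endpoints, and the times spent at vertices may form any closed set, so these times
need a separate argument. -/
theorem lineIntegral_eq_sum {K : NNReal} {G : ℝ → Fin n → ℝ}
    (hG : LipschitzOnWith K G (Icc 0 1)) (hGC : MapsTo G (Icc 0 1) C) (hcl : G 0 = G 1)
    (θ : Fin k → ℝ → ℝ) (hθ : ∀ i, ContinuousOn (θ i) (Icc 0 1))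
    (hθG : ∀ i, ∀ t ∈ Icc (0 : ℝ) 1, (θ i t : UnitAddCircle) = arcCoord (h i) (G t))
    {P : (Fin n → ℝ) → ℝ} (hP : Continuous P) (s : Fin n) :
    lineIntegral P s G 0 1 = ∑ i, (θ i 1 - θ i 0) * lineIntegral P s (h i) 0 1 := by
  choose Kh hKh using fun i => (hT.isArc i).lipschitz
  set U : ℝ → ℝ := fun t => ∑ i, quasiPrimitive P s (h i) (θ i t) with hU
  set W : ℝ → ℝ := fun t => U t - lineIntegral P s G 0 t with hW
  have hWsub : ∀ t ∈ Icc (0 : ℝ) 1, ∀ t' ∈ Icc (0 : ℝ) 1,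
      W t' - W t = U t' - U t - lineIntegral P s G t t' := by
    intro t ht t' ht'
    have := lineIntegral_add hG s hP (x := 0) (by simp) ht ht'
    simp only [hW]
    linarith
  have hGcont := hG.continuousOn
  have hclose : ∀ t ∈ Icc (0 : ℝ) 1, ∀ ε > 0, ∃ δ > 0, ∀ t' ∈ Icc (0 : ℝ) 1, |t' - t| < δ →
      |lineIntegral P s G t t' - P (G t) * (G t' s - G t s)| ≤ ε * |t' - t| := by
    intro t ht ε hε
    have hε' : 0 < ε / (K + 1) := by positivity
    obtain ⟨δ, hδ, hδ'⟩ := Metric.continuousOn_iff.1 (hP.comp_continuousOn hGcont) t ht _ hε'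
    refine ⟨δ, hδ, fun t' ht' htt => ?_⟩
    refine (abs_lineIntegral_sub_le hG s hP ht ht' (c := P (G t)) (ε := ε / (K + 1)) ?_).trans ?_
    · intro u hu
      refine (hδ' u (uIcc_subset_Icc ht ht' hu) ?_).le
      rw [Real.dist_eq]
      exact (abs_sub_left_of_mem_uIcc hu).trans_lt htt
    · refine mul_le_mul_of_nonneg_right ?_ (abs_nonneg _)
      rw [div_mul_eq_mul_div, div_le_iff₀ (by positivity)]
      nlinarith
  have hconst : W 1 = W 0 := by
    refine eq_of_hasDerivWithinAt_zero_of_closed (Z := {t | G t ∈ vertices h}) ?_ ?_ ?_ ?_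
    · refine ContinuousOn.sub ?_ (continuousOn_lineIntegral hG s hP)
      exact continuousOn_finsetSum _ fun i _ =>
        (continuous_quasiPrimitive (hKh i) s hP).comp_continuousOn (hθ i)
    · rw [inter_comm]
      exact hGcont.preimage_isClosed_of_isClosed isClosed_Icc (finite_vertices h).isClosed
    · intro t ht htZ
      obtain ⟨i, τ₀, hτ₀, hτG⟩ := hT.exists_arc_of_notMem_vertices (hGC ht) htZ
      obtain ⟨m, τ, hτt, hτc, hτ⟩ := hT.eventually_lift_sub hGcont hGC (hθ i) (hθG i) ht hτ₀ hτG
      have hoth : ∀ᶠ u in 𝓝[Icc 0 1] t, ∀ j, j ≠ i → θ j u = θ j t := by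
        rw [Filter.eventually_all]
        intro j
        by_cases hij : j = i
        · exact Filter.Eventually.of_forall fun u h => absurd hij h
        · filter_upwards [hT.eventually_lift_eq hGcont hGC hij (hθ j) (hθG j) ht hτ₀ hτG]
            with u hu _ using hu
      obtain ⟨L, O, hO, hL⟩ := (hT.isArc i).inverse_lipschitz τ₀ hτ₀
      rw [hτG] at hO
      have hL0 : 0 ≤ |L| := abs_nonneg L
      have hlipτ : ∀ᶠ u in 𝓝[Icc 0 1] t, |τ u - τ₀| ≤ |L| * K * |u - t| := by
        filter_upwards [hτ, (hGcont t ht) hO, self_mem_nhdsWithin] with u hu huO huI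
        have h1 := hL (τ u) hu.1 τ₀ (Ioo_subset_Icc_self hτ₀) (by rw [hu.2.1]; exact huO)
          (by rw [hτG]; exact mem_of_mem_nhds hO)
        rw [hu.2.1, hτG] at h1
        have h2 : ‖G u - G t‖ ≤ K * |u - t| := hG.norm_sub_le huI ht
        calc |τ u - τ₀| ≤ L * ‖G u - G t‖ := h1
          _ ≤ |L| * ‖G u - G t‖ := mul_le_mul_of_nonneg_right (le_abs_self _) (norm_nonneg _)
          _ ≤ |L| * (K * |u - t|) := mul_le_mul_of_nonneg_left h2 hL0
          _ = _ := by ring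
      rw [hasDerivWithinAt_iff_isLittleO, Asymptotics.isLittleO_iff]
      intro ε hε
      -- A Lipschitz bound at `t` for the arc composed with the local parameter `τ`, increased by
      -- `1` to be positive.
      set B : ℝ := Kh i * (|L| * K) + 1 with hB
      have hBpos : 0 < B := by positivity
      have hε2 : 0 < ε / 2 / B := by positivity
      obtain ⟨δ, hδ, hδ'⟩ := Metric.continuousOn_iff.1
        (hP.comp_continuousOn (hT.isArc i).continuousOn) τ₀ (Ioo_subset_Icc_self hτ₀) _ hε2
      obtain ⟨δ₂, hδ₂, hδ₂'⟩ := hclose t ht (ε / 2) (by positivity)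
      have hτδ : ∀ᶠ u in 𝓝[Icc 0 1] t, |τ u - τ₀| < δ := by
        have := hτc (Metric.ball_mem_nhds (τ t) hδ)
        filter_upwards [this] with u hu
        rw [mem_preimage, Metric.mem_ball, Real.dist_eq, hτt] at hu
        exact hu
      filter_upwards [hτ, hoth, hlipτ, hτδ, self_mem_nhdsWithin,
        mem_nhdsWithin_of_mem_nhds (Metric.ball_mem_nhds t hδ₂)] with u hu hju hlu huδ huI hub
      rw [Metric.mem_ball, Real.dist_eq] at hub
      simp only [smul_eq_mul, mul_zero, sub_zero, Real.norm_eq_abs]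
      have hUi : U u - U t = lineIntegral P s (h i) τ₀ (τ u) := by
        simp only [hU]
        rw [← Finset.sum_sub_distrib, Finset.sum_eq_single_of_mem i (Finset.mem_univ i)]
        · rw [hu.2.2, (hτ.self_of_nhdsWithin ht).2.2, hτt, quasiPrimitive_add_int (hKh i) s hP,
            quasiPrimitive_add_int (hKh i) s hP, quasiPrimitive_eq _ _ _ hu.1,
            quasiPrimitive_eq _ _ _ (Ioo_subset_Icc_self hτ₀)]
          have := lineIntegral_add (hKh i) s hP (x := 0) (by simp) (Ioo_subset_Icc_self hτ₀) hu.1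
          linarith
        · intro j _ hj
          rw [hju j hj, sub_self]
      have e1 : |lineIntegral P s (h i) τ₀ (τ u) - P (G t) * (G u s - G t s)| ≤
          ε / 2 * |u - t| := by
        have := abs_lineIntegral_sub_le (hKh i) s hP (Ioo_subset_Icc_self hτ₀) hu.1 (c := P (G t))
          (ε := ε / 2 / B) (fun v hv => by
            rw [← hτG]
            refine (hδ' v (uIcc_subset_Icc (Ioo_subset_Icc_self hτ₀) hu.1 hv) ?_).le
            rw [Real.dist_eq]
            exact (abs_sub_left_of_mem_uIcc hv).trans_lt huδ)
        rw [hu.2.1, hτG] at this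
        refine this.trans ?_
        calc ε / 2 / B * Kh i * |τ u - τ₀| ≤ ε / 2 / B * Kh i * (|L| * K * |u - t|) :=
              mul_le_mul_of_nonneg_left hlu (by positivity)
          _ = ε / 2 * ((Kh i * (|L| * K)) / B) * |u - t| := by ring
          _ ≤ ε / 2 * 1 * |u - t| := by
              gcongr
              rw [div_le_one hBpos, hB]
              linarith
          _ = _ := by ring
      have e2 := hδ₂' u huI hub
      rw [hWsub t ht u huI, hUi]
      rw [abs_le] at e1 e2 ⊢
      constructor <;> linarith [e1.1, e1.2, e2.1, e2.2]
    -- At times in vertices the lifts are integers and the vertices are isolated. So near `t`, along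
    -- such times, both `U` and `G` are constant, and only the error in the expansion of the
    -- integral remains.
    · rintro t ⟨htZ, ht⟩ ε hε
      obtain ⟨δ₂, hδ₂, hδ₂'⟩ := hclose t ht ε hε
      have hvert : ∀ᶠ u in 𝓝[Icc 0 1] t, G u ∈ vertices h → G u = G t := by
        have hcl : IsClosed (vertices h \ {G t}) := ((finite_vertices h).sdiff).isClosed
        have : (vertices h \ {G t})ᶜ ∈ 𝓝 (G t) := hcl.isOpen_compl.mem_nhds (by simp)
        filter_upwards [(hGcont t ht) this] with u hu huv
        by_contra hne
        exact hu ⟨huv, hne⟩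
      have hloc : ∀ᶠ u in 𝓝[Icc 0 1] t, ∀ i, |θ i u - θ i t| < 1 := by
        rw [Filter.eventually_all]
        intro i
        filter_upwards [(hθ i t ht) (Metric.ball_mem_nhds (θ i t) one_pos)] with u hu
        exact hu
      obtain ⟨δ₁, hδ₁, hδ₁'⟩ := Metric.mem_nhdsWithin_iff.1 (hvert.and hloc)
      refine ⟨min δ₁ δ₂, lt_min hδ₁ hδ₂, ?_⟩
      rintro u ⟨huZ, huI⟩ hut
      obtain ⟨hv, hl⟩ := hδ₁' ⟨by
        rw [Metric.mem_ball, Real.dist_eq]; exact hut.trans_le (min_le_left _ _), huI⟩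
      have hGu := hv huZ
      have hUu : U u = U t := by
        simp only [hU]
        refine Finset.sum_congr rfl fun i _ => ?_
        have h0 : ∀ v ∈ Icc (0 : ℝ) 1, G v ∈ vertices h → ∃ l : ℤ, θ i v = l := fun v hv hvZ =>
          exists_int_of_coe_eq_zero (by rw [hθG i v hv, hT.arcCoord_vertex i hvZ])
        obtain ⟨l, hl1⟩ := h0 u huI huZ
        obtain ⟨l', hl2⟩ := h0 t ht htZ
        have := hl i
        rw [hl1, hl2] at this ⊢
        have : |l - l'| < 1 := by exact_mod_cast this
        rw [Int.abs_lt_one_iff, sub_eq_zero] at this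
        rw [this]
      have e2 := hδ₂' u huI (hut.trans_le (min_le_right _ _))
      rw [hGu, sub_self, mul_zero, sub_zero] at e2
      rw [hWsub t ht u huI, hUu, sub_self, zero_sub, abs_neg]
      exact e2
  have h10 := hWsub 0 (by simp) 1 (by simp)
  rw [hconst, sub_self] at h10
  have hUsum : U 1 - U 0 = ∑ i, (θ i 1 - θ i 0) * lineIntegral P s (h i) 0 1 := by
    simp only [hU]
    rw [← Finset.sum_sub_distrib]
    refine Finset.sum_congr rfl fun i _ => ?_
    obtain ⟨m, hm⟩ : ∃ m : ℤ, θ i 1 - θ i 0 = m := by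
      refine exists_int_of_coe_eq_zero ?_
      rw [AddCircle.coe_sub, hθG i 1 (by simp), hθG i 0 (by simp), hcl, sub_self]
    have : θ i 1 = θ i 0 + m := by linarith
    rw [hm, this, quasiPrimitive_add_int (hKh i) s hP,
      quasiPrimitive_eq P s (h i) (x := 1) (by simp)]
    ring
  rw [← hUsum]
  linarith

end IsLipschitzTriangulation

end MomentsCurve
end

noncomputable section
namespace MomentsCurve

open scoped unitInterval

/-! ### The homology class of a simple closed curve in a triangulated set -/

section Potential

variable {X : Type*} [TopologicalSpace X] [PathConnectedSpace X] (x₀ : X)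

/-- The homology class of the piece from `0` to `τ` of a curve parametrized by the real line. -/
def potential (e : C(ℝ, X)) (τ : ℝ) : Additive (Abelianization (FundamentalGroup X x₀)) :=
  h1Class x₀ ((PathConnectedSpace.somePath 0 τ).map e.continuous)

/-- The real line is simply connected, so the class of the image path depends only on the endpoints
of the path in the line. -/
theorem h1Class_map_eq (e : C(ℝ, X)) {a b : ℝ} (q : Path a b) :
    h1Class x₀ (q.map e.continuous) = potential x₀ e b - potential x₀ e a := by
  rw [eq_sub_iff_add_eq', potential, potential, ← h1Class_trans, ← Path.map_trans]
  exact h1Class_congr x₀ ((SimplyConnectedSpace.paths_homotopic _ _).map e)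

theorem potential_zero (e : C(ℝ, X)) : potential x₀ e 0 = 0 := by
  have := h1Class_map_eq x₀ e (Path.refl 0)
  rw [sub_self] at this
  rw [← this]
  exact h1Class_congr x₀ ((SimplyConnectedSpace.paths_homotopic _ _).map e)

end Potential

/-- The quasi-periodic extension of a function on `[0,1]` that vanishes at `0`. -/
def quasiExtend {A : Type*} [AddCommGroup A] (H : ℝ → A) (x : ℝ) : A :=
  ⌊x⌋ • H 1 + H (Int.fract x)

theorem quasiExtend_add_int {A : Type*} [AddCommGroup A] {H : ℝ → A} (h0 : H 0 = 0) {τ : ℝ}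
    (hτ : τ ∈ Icc (0 : ℝ) 1) (m : ℤ) : quasiExtend H (τ + m) = m • H 1 + H τ := by
  rw [quasiExtend, Int.fract_add_intCast, Int.floor_add_intCast]
  rcases hτ.2.eq_or_lt with rfl | hlt
  · simp [h0, add_smul, add_comm]
  · rw [Int.floor_eq_zero_iff.2 ⟨hτ.1, hlt⟩, Int.fract_eq_self.2 ⟨hτ.1, hlt⟩, zero_add]

variable {n k : ℕ} {C Γ : Set (Fin n → ℝ)} {h : Fin k → ℝ → Fin n → ℝ}

namespace IsLipschitzTriangulation

variable (hT : IsLipschitzTriangulation C h)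
include hT

/-- One arc and the union of the others are closed and meet only in vertices; a connected set
without vertices cannot meet both. -/
theorem subset_arc_of_isPreconnected {S : Set (Fin n → ℝ)} (hS : IsPreconnected S) (hSC : S ⊆ C)
    (hV : Disjoint S (vertices h)) (hne : S.Nonempty) : ∃ i, S ⊆ arc (h i) := by
  obtain ⟨x, hx⟩ := hne
  obtain ⟨i, t, ht, htx⟩ := hT.exists_arc (hSC hx)
  refine ⟨i, ?_⟩
  by_contra hnot
  obtain ⟨z, hzS, hzi⟩ := not_subset.1 hnot
  have hcov : ∀ w ∈ S, w ∉ arc (h i) → w ∈ ⋃ j : {j // j ≠ i}, arc (h j) := by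
    intro w hw hwi
    obtain ⟨j, u, hu, rfl⟩ := hT.exists_arc (hSC hw)
    refine mem_iUnion.2 ⟨⟨j, ?_⟩, mem_arc (h j) hu⟩
    rintro rfl
    exact hwi (mem_arc _ hu)
  obtain ⟨w, hwS, hwi, hw⟩ := isPreconnected_closed_iff.1 hS _ _ (hT.isArc i).isCompact.isClosed
    (isClosed_iUnion_of_finite fun j : {j // j ≠ i} => (hT.isArc j).isCompact.isClosed)
    (fun w hw => by
      by_cases hwi : w ∈ arc (h i)
      · exact Or.inl hwi
      · exact Or.inr (hcov w hw hwi))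
    ⟨x, hx, htx ▸ mem_arc _ ht⟩ ⟨z, hzS, hcov z hzS hzi⟩
  obtain ⟨j, hj⟩ := mem_iUnion.1 hw
  have := (hT.endpoints i j j.2.symm ⟨hwi, hj⟩).1
  exact disjoint_left.1 hV hwS (mem_iUnion.2 ⟨i, this⟩)

/-- The arcs of a triangulation as maps from the real line to a set that contains them. -/
def arcMap (hC : C ⊆ Γ) (i : Fin k) : C(ℝ, Γ) where
  toFun t := ⟨h i (projIcc 0 1 zero_le_one t), hC (hT.arc_subset i (mem_arc _ (Subtype.prop _)))⟩
  continuous_toFun := by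
    refine Continuous.subtype_mk ?_ _
    exact (hT.isArc i).continuousOn.domRestrict.comp continuous_projIcc

theorem arcMap_apply (hC : C ⊆ Γ) (i : Fin k) {t : ℝ} (ht : t ∈ Icc (0 : ℝ) 1) :
    (hT.arcMap hC i t : Fin n → ℝ) = h i t := by
  change h i (projIcc 0 1 zero_le_one t) = h i t
  rw [projIcc_of_mem _ ht]

/-- Within one arc the subpath is the image of a path of parameters, whose class is a difference of
potentials. There `θ i` is the parameter plus a fixed integer, and the other lifts are constant. -/
theorem h1Class_sub_eq_of_subset_arc [PathConnectedSpace Γ] (x₀ : Γ) (hC : C ⊆ Γ) {y : Γ}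
    (p : Path y y) {θ : Fin k → I → ℝ} (hθ : ∀ i, Continuous (θ i))
    (hθp : ∀ i t, (θ i t : UnitAddCircle) = arcCoord (h i) (p t)) {t₁ t₂ : I} (ht : t₁ ≤ t₂)
    (i : Fin k) (hi : ∀ t ∈ Icc t₁ t₂, (p t : Fin n → ℝ) ∈ arc (h i)) :
    h1Class x₀ (p.subpath t₁ t₂) =
      ∑ j, quasiExtend (potential x₀ (hT.arcMap hC j)) (θ j t₂) -
        ∑ j, quasiExtend (potential x₀ (hT.arcMap hC j)) (θ j t₁) := by
  set inv := Function.invFunOn (h i) (Icc 0 1) with hinv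
  set τ : I → ℝ := fun t => inv (p t) with hτ
  have hτI : ∀ t ∈ Icc t₁ t₂, τ t ∈ Icc (0 : ℝ) 1 := fun t ht => Function.invFunOn_mem (hi t ht)
  have hτp : ∀ t ∈ Icc t₁ t₂, h i (τ t) = p t := fun t ht => Function.invFunOn_eq (hi t ht)
  have hτc : ContinuousOn τ (Icc t₁ t₂) :=
    (hT.isArc i).continuousOn_invFunOn.comp (by fun_prop) hi
  have hpre : IsPreconnected (Icc t₁ t₂) := isPreconnected_Icc
  have h1 : t₁ ∈ Icc t₁ t₂ := left_mem_Icc.2 ht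
  have h2 : t₂ ∈ Icc t₁ t₂ := right_mem_Icc.2 ht
  have hother : ∀ j, j ≠ i → θ j t₂ = θ j t₁ := fun j hj =>
    eq_of_coe_unitAddCircle_eq_zero hpre (hθ j).continuousOn (fun t ht => by
      rw [hθp]; exact hT.arcCoord_eq_zero_of_mem hj (hi t ht)) h2 h1
  have hz : ∀ t ∈ Icc t₁ t₂, ((θ i t - τ t : ℝ) : UnitAddCircle) = 0 := fun t ht => by
    rw [AddCircle.coe_sub, hθp, sub_eq_zero, ← hτp t ht]
    exact (hT.isArc i).arcCoord_apply (hτI t ht)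
  obtain ⟨m, hm⟩ := exists_int_of_coe_eq_zero (hz t₁ h1)
  have hm2 : θ i t₂ - τ t₂ = m := by
    rw [← hm]
    exact eq_of_coe_unitAddCircle_eq_zero (g := fun t => θ i t - τ t) hpre
      ((hθ i).continuousOn.sub hτc) hz h2 h1
  rw [← Finset.sum_sub_distrib, Finset.sum_eq_single_of_mem i (Finset.mem_univ i)
    (fun j _ hj => by rw [hother j hj, sub_self])]
  rw [show θ i t₂ = τ t₂ + m by linarith, show θ i t₁ = τ t₁ + m by linarith,
    quasiExtend_add_int (potential_zero x₀ _) (hτI _ h2),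
    quasiExtend_add_int (potential_zero x₀ _) (hτI _ h1), add_sub_add_left_eq_sub]
  have hcomb : ∀ u : I, Icc.convexComb t₁ t₂ u ∈ Icc t₁ t₂ := fun u => by
    rw [← uIcc_of_le ht, ← Path.range_subpathAux t₁ t₂]
    exact mem_range_self u
  let q : Path (τ t₁) (τ t₂) :=
    { toFun := fun u => τ (Icc.convexComb t₁ t₂ u)
      continuous_toFun := hτc.comp_continuous (by fun_prop) hcomb
      source' := by simp
      target' := by simp }
  have hends : ∀ t ∈ Icc t₁ t₂, p t = hT.arcMap hC i (τ t) := fun t ht =>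
    Subtype.ext (by rw [hT.arcMap_apply hC i (hτI t ht), hτp t ht])
  rw [← h1Class_map_eq x₀ _ q, ← h1Class_cast x₀ _ (hends t₁ h1) (hends t₂ h2)]
  congr 1
  refine DFunLike.coe_injective (funext fun u => ?_)
  exact hends _ (hcomb u)

/-- The homological counterpart of `lineIntegral_eq_sum`. A simple curve visits the finitely many
vertices at finitely many times; between consecutive ones it stays in one arc. So the class of the
initial piece minus the sum `∑ quasiExtend` at the lifts is locally constant in time. -/
theorem h1Class_eq_sum [PathConnectedSpace Γ] (x₀ : Γ) (hC : C ⊆ Γ) {y : Γ}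
    (p : Path y y) (hpC : ∀ t, (p t : Fin n → ℝ) ∈ C) (hinj : InjOn p {t | t ≠ 1})
    {θ : Fin k → I → ℝ} (hθ : ∀ i, Continuous (θ i))
    (hθp : ∀ i t, (θ i t : UnitAddCircle) = arcCoord (h i) (p t)) :
    ∃ z : Fin k → ℤ, (∀ i, θ i 1 - θ i 0 = z i) ∧
      h1Class x₀ p = ∑ i, z i • potential x₀ (hT.arcMap hC i) 1 := by
  set T : Set I := {t | (p t : Fin n → ℝ) ∈ vertices h} with hTdef
  have hTfin : T.Finite := by
    have : T ⊆ {1} ∪ {t | t ≠ 1} ∩ (fun t => (p t : Fin n → ℝ)) ⁻¹' vertices h := by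
      intro t ht
      by_cases h1 : t = 1
      · exact Or.inl h1
      · exact Or.inr ⟨h1, ht⟩
    refine Finite.subset ((finite_singleton _).union ?_) this
    refine Finite.of_finite_image (f := fun t => (p t : Fin n → ℝ))
      ((finite_vertices h).subset ?_) ?_
    · rintro _ ⟨t, ht, rfl⟩; exact ht.2
    · exact fun t ht u hu htu => hinj ht.1 hu.1 (Subtype.ext htu)
  set D : I → Additive (Abelianization (FundamentalGroup Γ x₀)) := fun t =>
    h1Class x₀ (p.subpath 0 t) -
      ∑ j, quasiExtend (potential x₀ (hT.arcMap hC j)) (θ j t) with hD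
  have hstep : ∀ t₁ t₂ : I, t₁ < t₂ → (∀ t ∈ Ioo t₁ t₂, t ∉ T) → D t₁ = D t₂ := by
    intro t₁ t₂ ht hno
    have hpcont : Continuous fun t => (p t : Fin n → ℝ) := by fun_prop
    obtain ⟨i, hi⟩ := hT.subset_arc_of_isPreconnected
      (S := (fun t => (p t : Fin n → ℝ)) '' Ioo t₁ t₂)
      (isPreconnected_Ioo.image _ hpcont.continuousOn)
      (by rintro _ ⟨t, -, rfl⟩; exact hpC t)
      (disjoint_left.2 (by rintro _ ⟨t, ht, rfl⟩; exact hno t ht))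
      ((nonempty_Ioo.2 ht).image _)
    have hi' : ∀ t ∈ Icc t₁ t₂, (p t : Fin n → ℝ) ∈ arc (h i) := by
      have hcl : IsClosed ((fun t => (p t : Fin n → ℝ)) ⁻¹' arc (h i)) :=
        (hT.isArc i).isCompact.isClosed.preimage hpcont
      have := closure_minimal (image_subset_iff.1 hi) hcl
      rwa [closure_Ioo ht.ne] at this
    have h1 := hT.h1Class_sub_eq_of_subset_arc x₀ hC p hθ hθp ht.le i hi'
    have h2 : h1Class x₀ (p.subpath 0 t₁) + h1Class x₀ (p.subpath t₁ t₂) =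
        h1Class x₀ (p.subpath 0 t₂) := by
      rw [← h1Class_trans]
      exact h1Class_congr x₀ ⟨Path.Homotopy.subpathTransSubpath p 0 t₁ t₂⟩
    simp only [hD]
    rw [← h2, h1]
    abel
  have hloc : IsLocallyConstant D := by
    rw [IsLocallyConstant.iff_eventually_eq]
    intro t
    have hopen : (T \ {t})ᶜ ∈ 𝓝 t := (hTfin.sdiff).isClosed.isOpen_compl.mem_nhds (by simp)
    obtain ⟨ε, hε, hball⟩ := Metric.mem_nhds_iff.1 hopen
    filter_upwards [Metric.ball_mem_nhds t hε] with u hu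
    have hno : ∀ v, v ≠ t → dist v t ≤ dist u t → v ∉ T := fun v hvt hv hvT =>
      hball (show v ∈ Metric.ball t ε from lt_of_le_of_lt hv hu) ⟨hvT, hvt⟩
    rcases lt_trichotomy u t with hlt | rfl | hlt
    · refine hstep u t hlt fun v hv => hno v hv.2.ne ?_
      have h1 : (u : ℝ) < v := hv.1
      have h2 : (v : ℝ) < t := hv.2
      rw [Subtype.dist_eq, Subtype.dist_eq, Real.dist_eq, Real.dist_eq,
        abs_of_neg (by linarith), abs_of_neg (by linarith)]
      linarith
    · rfl
    · refine (hstep t u hlt fun v hv => hno v hv.1.ne' ?_).symm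
      have h1 : (t : ℝ) < v := hv.1
      have h2 : (v : ℝ) < u := hv.2
      rw [Subtype.dist_eq, Subtype.dist_eq, Real.dist_eq, Real.dist_eq,
        abs_of_pos (by linarith), abs_of_pos (by linarith)]
      linarith
  have h10 : D 1 = D 0 := hloc.apply_eq_of_preconnectedSpace 1 0
  have hz : ∀ i, ∃ z : ℤ, θ i 1 - θ i 0 = z := fun i => exists_int_of_coe_eq_zero (by
    rw [AddCircle.coe_sub, hθp, hθp, p.source, p.target, sub_self])
  choose z hz using hz
  refine ⟨z, hz, ?_⟩
  simp only [hD] at h10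
  rw [Path.subpath_self, Path.subpath_zero_one, h1Class_refl, h1Class_cast] at h10
  have h11 : h1Class x₀ p = ∑ j, quasiExtend (potential x₀ (hT.arcMap hC j)) (θ j 1) -
      ∑ j, quasiExtend (potential x₀ (hT.arcMap hC j)) (θ j 0) := by
    rw [zero_sub, sub_eq_iff_eq_add] at h10
    rw [h10]; abel
  rw [h11, ← Finset.sum_sub_distrib]
  refine Finset.sum_congr rfl fun i _ => ?_
  have e : θ i 1 = Int.fract (θ i 0) + ((⌊θ i 0⌋ + z i : ℤ) : ℝ) := by
    push_cast
    rw [← hz i]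
    linarith [Int.fract_add_floor (θ i 0)]
  rw [e, quasiExtend_add_int (potential_zero x₀ _)
    ⟨Int.fract_nonneg _, (Int.fract_lt_one _).le⟩, quasiExtend, add_smul]
  abel

end IsLipschitzTriangulation

end MomentsCurve
end

noncomputable section
namespace MomentsCurve

/-! ### Bump functions of cubes -/

variable {n k : ℕ}

/-- A bump function of the cube with center `c` and radius `r`, equal to `1` on the cube of half
the size. -/
def cubeBump (c : Fin n → ℝ) (r : ℝ) (x : Fin n → ℝ) : ℝ :=
  min 1 (2 / r * max 0 (r - ‖x - c‖))

theorem continuous_cubeBump (c : Fin n → ℝ) (r : ℝ) : Continuous (cubeBump c r) := by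
  unfold cubeBump; fun_prop

theorem cubeBump_nonneg (c : Fin n → ℝ) {r : ℝ} (hr : 0 < r) (x : Fin n → ℝ) :
    0 ≤ cubeBump c r x := le_min zero_le_one (by positivity)

theorem cubeBump_eq_zero {c : Fin n → ℝ} {r : ℝ} {x : Fin n → ℝ} (hx : x ∉ Metric.ball c r) :
    cubeBump c r x = 0 := by
  rw [mem_ball_iff_norm, not_lt] at hx
  rw [cubeBump, max_eq_left (by linarith)]
  simp

theorem cubeBump_eq_one {c : Fin n → ℝ} {r : ℝ} (hr : 0 < r) {x : Fin n → ℝ}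
    (hx : x ∈ Metric.ball c (r / 2)) : cubeBump c r x = 1 := by
  rw [mem_ball_iff_norm] at hx
  rw [cubeBump, min_eq_left]
  rw [div_mul_eq_mul_div, one_le_div hr]
  have := le_max_right 0 (r - ‖x - c‖)
  linarith

theorem cubeBump_le {c : Fin n → ℝ} {r : ℝ} {x : Fin n → ℝ}
    (hx : x ∈ Metric.ball c r) : cubeBump c r x ≤ 2 / r * (r - ‖x - c‖) := by
  rw [mem_ball_iff_norm] at hx
  refine (min_le_right _ _).trans ?_
  rw [max_eq_right (by linarith)]

theorem abs_cubeBump_sub_le (c : Fin n → ℝ) {r : ℝ} (hr : 0 < r) (x y : Fin n → ℝ) :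
    |cubeBump c r x - cubeBump c r y| ≤ 2 / r * ‖x - y‖ := by
  have h1 := abs_min_sub_min_le_max 1 (2 / r * max 0 (r - ‖x - c‖)) 1
    (2 / r * max 0 (r - ‖y - c‖))
  rw [sub_self, abs_zero, ← mul_sub, abs_mul, abs_of_pos (show 0 < 2 / r by positivity)] at h1
  refine (h1.trans_eq (max_eq_right (by positivity))).trans (mul_le_mul_of_nonneg_left ?_ (by positivity))
  have h2 := abs_max_sub_max_le_max 0 (r - ‖x - c‖) 0 (r - ‖y - c‖)
  rw [sub_self, abs_zero] at h2
  refine (h2.trans_eq (max_eq_right (abs_nonneg _))).trans ?_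
  rw [sub_sub_sub_cancel_left]
  have := abs_norm_sub_norm_le (y - c) (x - c)
  rwa [sub_sub_sub_cancel_right, norm_sub_rev y x] at this

theorem sum_cubeBump_eq {c : Fin k → Fin n → ℝ} {r : Fin k → ℝ} (τ : Fin k → ℝ) (i : Fin k)
    {x : Fin n → ℝ} (hx : ∀ j, j ≠ i → x ∉ Metric.ball (c j) (r j)) :
    ∑ j, τ j * cubeBump (c j) (r j) x = τ i * cubeBump (c i) (r i) x :=
  Finset.sum_eq_single_of_mem i (Finset.mem_univ i) fun j _ hj => by
    rw [cubeBump_eq_zero (hx j hj), mul_zero]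

/-- The constant is that of a single bump: for points in two different cubes, disjointness gives
that their distance is at least the sum of their depths `r i - ‖x - c i‖`, and the bumps are bounded
by `2 / r i` times these depths. -/
theorem abs_sum_cubeBump_sub_le {c : Fin k → Fin n → ℝ} {r : Fin k → ℝ} {ρ : ℝ} (hρ : 0 < ρ)
    (hr : ∀ i, ρ ≤ r i)
    (hd : ∀ i j, i ≠ j → Disjoint (Metric.ball (c i) (r i)) (Metric.ball (c j) (r j)))
    {τ : Fin k → ℝ} (hτ : ∀ i, |τ i| ≤ 1) (x y : Fin n → ℝ) :
    |∑ i, τ i * cubeBump (c i) (r i) x - ∑ i, τ i * cubeBump (c i) (r i) y| ≤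
      2 / ρ * ‖x - y‖ := by
  have hrpos : ∀ i, 0 < r i := fun i => hρ.trans_le (hr i)
  have hle : ∀ i, 2 / r i ≤ 2 / ρ := fun i => div_le_div_of_nonneg_left (by norm_num) hρ (hr i)
  have hsame : ∀ i, (∀ j, j ≠ i → x ∉ Metric.ball (c j) (r j)) →
      (∀ j, j ≠ i → y ∉ Metric.ball (c j) (r j)) →
      |∑ i, τ i * cubeBump (c i) (r i) x - ∑ i, τ i * cubeBump (c i) (r i) y| ≤
        2 / ρ * ‖x - y‖ := by
    intro i hx hy
    rw [sum_cubeBump_eq τ i hx, sum_cubeBump_eq τ i hy, ← mul_sub, abs_mul]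
    calc _ ≤ 1 * (2 / r i * ‖x - y‖) := mul_le_mul (hτ i) (abs_cubeBump_sub_le _ (hrpos i) _ _)
          (abs_nonneg _) zero_le_one
      _ ≤ _ := by rw [one_mul]; exact mul_le_mul_of_nonneg_right (hle i) (norm_nonneg _)
  have huniq : ∀ i z, z ∈ Metric.ball (c i) (r i) → ∀ j, j ≠ i → z ∉ Metric.ball (c j) (r j) :=
    fun i z hz j hj hz' => disjoint_left.1 (hd j i hj) hz' hz
  have hnone : ∀ z : Fin n → ℝ, (∀ j, z ∉ Metric.ball (c j) (r j)) →
      ∑ i, τ i * cubeBump (c i) (r i) z = 0 := fun z hz =>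
    Finset.sum_eq_zero fun j _ => by rw [cubeBump_eq_zero (hz j), mul_zero]
  by_cases hx : ∃ i, x ∈ Metric.ball (c i) (r i)
  · obtain ⟨i, hi⟩ := hx
    by_cases hy : ∃ j, j ≠ i ∧ y ∈ Metric.ball (c j) (r j)
    · obtain ⟨j, hji, hj⟩ := hy
      rw [sum_cubeBump_eq τ i (huniq i x hi), sum_cubeBump_eq τ j (huniq j y hj)]
      have hij := (disjoint_ball_ball_iff (hrpos j) (hrpos i)).1 (hd j i hji)
      rw [dist_eq_norm] at hij
      have htri : ‖c j - c i‖ ≤ ‖y - c j‖ + ‖x - y‖ + ‖x - c i‖ := by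
        have e : c j - c i = -(y - c j) + (-(x - y) + (x - c i)) := by abel
        rw [e]
        refine (norm_add_le _ _).trans ?_
        have := norm_add_le (-(x - y)) (x - c i)
        rw [norm_neg] at this ⊢
        linarith
      have hbd : ∀ i z, z ∈ Metric.ball (c i) (r i) →
          |τ i * cubeBump (c i) (r i) z| ≤ 2 / ρ * (r i - ‖z - c i‖) := by
        intro i z hz
        rw [abs_mul, abs_of_nonneg (cubeBump_nonneg _ (hrpos i) _)]
        rw [mem_ball_iff_norm] at hz
        calc _ ≤ 1 * (2 / r i * (r i - ‖z - c i‖)) :=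
              mul_le_mul (hτ i) (cubeBump_le (mem_ball_iff_norm.2 hz))
                (cubeBump_nonneg _ (hrpos i) _) zero_le_one
          _ ≤ _ := by
            rw [one_mul]; exact mul_le_mul_of_nonneg_right (hle i) (by linarith)
      calc _ ≤ _ := abs_sub _ _
        _ ≤ 2 / ρ * (r i - ‖x - c i‖) + 2 / ρ * (r j - ‖y - c j‖) :=
            add_le_add (hbd i x hi) (hbd j y hj)
        _ = 2 / ρ * ((r i - ‖x - c i‖) + (r j - ‖y - c j‖)) := by ring
        _ ≤ _ := mul_le_mul_of_nonneg_left (by linarith) (by positivity)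
    · exact hsame i (huniq i x hi) fun j hj hyj => hy ⟨j, hj, hyj⟩
  · by_cases hy : ∃ i, y ∈ Metric.ball (c i) (r i)
    · obtain ⟨i, hi⟩ := hy
      exact hsame i (fun j _ hxj => hx ⟨j, hxj⟩) (huniq i y hi)
    · rw [hnone x fun j hj => hx ⟨j, hj⟩, hnone y fun j hj => hy ⟨j, hj⟩, sub_self, abs_zero]
      positivity

/-! ### The integral of a bump function along an arc -/

theorem volume_image_eq_zero {K : NNReal} {u : ℝ → ℝ} {S : Set ℝ} (hu : LipschitzOnWith K u S)
    (hS : volume S = 0) : volume (u '' S) = 0 := by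
  have := hu.hausdorffMeasure_image_le (d := 1) zero_le_one
  rw [hausdorffMeasure_real, hS, mul_zero] at this
  exact nonpos_iff_eq_zero.1 this

/-- The area formula on the points of differentiability in `S`; the rest of `S` is null and has null
image, as `u` is Lipschitz. -/
theorem volume_image_le_integral {K : NNReal} {u g : ℝ → ℝ} {S : Set ℝ}
    (hu : LipschitzOnWith K u (Icc 0 1)) (hS : S ⊆ Icc 0 1) (hSm : MeasurableSet S)
    (hinj : InjOn u S) (hg : IntervalIntegrable g volume 0 1) (hg0 : ∀ t ∈ Ioo (0 : ℝ) 1, 0 ≤ g t)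
    (hgS : ∀ t ∈ S ∩ Ioo 0 1, g t = |deriv u t|) :
    (volume (u '' S)).toReal ≤ ∫ t in (0 : ℝ)..1, g t := by
  set S' : Set ℝ := S ∩ Ioo 0 1 ∩ {t | DifferentiableAt ℝ u t} with hS'
  have hS'm : MeasurableSet S' :=
    (hSm.inter measurableSet_Ioo).inter (measurableSet_of_differentiableAt ℝ u)
  have hnull : volume (S \ S') = 0 := by
    have hb1 : ∀ᵐ t : ℝ, t ≠ 1 := by simp [ae_iff]
    have hb0 : ∀ᵐ t : ℝ, t ≠ 0 := by simp [ae_iff]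
    have hall : ∀ᵐ t : ℝ, t ∉ S \ S' := by
      filter_upwards [hb0, hb1, hu.ae_differentiableWithinAt_of_mem_real] with t h0 h1 hd ht
      have htI := hS ht.1
      have htO : t ∈ Ioo (0 : ℝ) 1 := ⟨lt_of_le_of_ne htI.1 h0.symm, lt_of_le_of_ne htI.2 h1⟩
      exact ht.2 ⟨⟨ht.1, htO⟩, (hd htI).differentiableAt (Icc_mem_nhds htO.1 htO.2)⟩
    rw [ae_iff] at hall
    rwa [show {a | ¬ a ∉ S \ S'} = S \ S' by ext; simp only [mem_ofPred_eq, not_not]] at hall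
  have himg : volume (u '' S) ≤ volume (u '' S') := by
    have hsub : S' ⊆ S := fun t ht => ht.1.1
    rw [← union_sdiff_cancel hsub, image_union]
    refine (measure_union_le _ _).trans ?_
    rw [volume_image_eq_zero (hu.mono (sdiff_subset.trans hS)) hnull, add_zero]
  have hlin : volume (u '' S') = ∫⁻ t in S', ENNReal.ofReal |deriv u t| := by
    have := lintegral_image_eq_lintegral_abs_deriv_mul hS'm
      (fun t ht => (ht.2 : DifferentiableAt ℝ u t).hasDerivAt.hasDerivWithinAt)
      (hinj.mono fun t ht => ht.1.1) (fun _ => 1)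
    simpa using this
  have hlin2 : ∫⁻ t in S', ENNReal.ofReal |deriv u t| = ∫⁻ t in S', ENNReal.ofReal (g t) :=
    setLIntegral_congr_fun hS'm fun t ht => by simp only [hgS t ht.1]
  have hgI : IntegrableOn g (Ioo 0 1) :=
    (intervalIntegrable_iff_integrableOn_Ioo_of_le zero_le_one).1 hg
  have hS'O : S' ⊆ Ioo 0 1 := fun t ht => ht.1.2
  have hlin3 : ∫⁻ t in S', ENNReal.ofReal (g t) ≤ ENNReal.ofReal (∫ t in Ioo 0 1, g t) := by
    rw [ofReal_integral_eq_lintegral_ofReal hgI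
      ((ae_restrict_iff' measurableSet_Ioo).2 (Filter.Eventually.of_forall hg0))]
    exact lintegral_mono_set hS'O
  rw [intervalIntegral.integral_of_le zero_le_one, integral_Ioc_eq_integral_Ioo]
  refine ENNReal.toReal_le_of_le_ofReal (setIntegral_nonneg measurableSet_Ioo hg0) ?_
  calc _ ≤ _ := himg
    _ ≤ _ := by rw [hlin, hlin2]; exact hlin3

/-- A continuous injective function on an order connected set is monotone up to sign. -/
theorem exists_sign_strictMonoOn {u : ℝ → ℝ} {T : Set ℝ} (hT : OrdConnected T)
    (hu : ContinuousOn u T) (hinj : InjOn u T) :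
    ∃ η : ℝ, |η| = 1 ∧ StrictMonoOn (fun t => η * u t) T := by
  by_cases hex : ∃ a ∈ T, ∃ b ∈ T, a < b ∧ u a < u b
  · obtain ⟨a, ha, b, hb, hab, huab⟩ := hex
    refine ⟨1, abs_one, fun x hx y hy hxy => ?_⟩
    simp only [one_mul]
    have hlo : min a x ∈ T := by rcases min_choice a x with h | h <;> rw [h] <;> assumption
    have hhi : max b y ∈ T := by rcases max_choice b y with h | h <;> rw [h] <;> assumption
    have hsub : Icc (min a x) (max b y) ⊆ T := hT.out hlo hhi
    have ha' : a ∈ Icc (min a x) (max b y) := ⟨min_le_left _ _, hab.le.trans (le_max_left _ _)⟩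
    have hb' : b ∈ Icc (min a x) (max b y) := ⟨(min_le_left _ _).trans hab.le, le_max_left _ _⟩
    have hx' : x ∈ Icc (min a x) (max b y) := ⟨min_le_right _ _, hxy.le.trans (le_max_right _ _)⟩
    have hy' : y ∈ Icc (min a x) (max b y) := ⟨(min_le_right _ _).trans hxy.le, le_max_right _ _⟩
    rcases le_total (u (min a x)) (u (max b y)) with hle | hle
    · exact ContinuousOn.strictMonoOn_of_injOn_Icc (ha'.1.trans ha'.2) hle (hu.mono hsub)
        (hinj.mono hsub) hx' hy' hxy
    · have := ContinuousOn.strictAntiOn_of_injOn_Icc (ha'.1.trans ha'.2) hle (hu.mono hsub)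
        (hinj.mono hsub) ha' hb' hab
      exact absurd huab (not_lt.2 this.le)
  · refine ⟨-1, by simp, fun x hx y hy hxy => ?_⟩
    simp only [neg_mul, one_mul, neg_lt_neg_iff]
    refine lt_of_le_of_ne (not_lt.1 fun h => hex ⟨x, hx, y, hy, hxy, h⟩) fun h => ?_
    exact hxy.ne (hinj hx hy h.symm)

section Arc

variable {h : ℝ → Fin n → ℝ} (hh : IsLipschitzArc h) {c : Fin n → ℝ} {r : ℝ}
  {s : Fin n}

include hh in
-- The parameters with values in the cube form an interval, by connectedness. There the coordinate
-- is injective, hence monotone, so the integrand has constant sign and nothing cancels; on the half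
-- cube the bump is `1`, and integrating the derivative measures the projection.
theorem volume_proj_le_abs_lineIntegral (hr : 0 < r)
    (hconn : IsConnected (Metric.ball c r ∩ arc h))
    (hinj : InjOn (fun x : Fin n → ℝ => x s) (Metric.ball c r ∩ arc h)) :
    (volume ((fun x : Fin n → ℝ => x s) '' (Metric.ball c (r / 2) ∩ arc h))).toReal ≤
      |lineIntegral (cubeBump c r) s h 0 1| := by
  obtain ⟨K, hK⟩ := hh.lipschitz
  set T : Set ℝ := {t | t ∈ Icc (0 : ℝ) 1 ∧ h t ∈ Metric.ball c r} with hTdef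
  have hTimg : T = Function.invFunOn h (Icc 0 1) '' (Metric.ball c r ∩ arc h) := by
    ext t
    constructor
    · rintro ⟨ht, hb⟩
      exact ⟨h t, ⟨hb, mem_arc h ht⟩, hh.invFunOn_apply ht⟩
    · rintro ⟨x, ⟨hxb, t, ht, rfl⟩, rfl⟩
      rw [hh.invFunOn_apply ht]
      exact ⟨ht, hxb⟩
  have hTconn : OrdConnected T := by
    rw [hTimg]
    exact (hconn.isPreconnected.image _
      (hh.continuousOn_invFunOn.mono inter_subset_right)).ordConnected
  set u : ℝ → ℝ := fun t => h t s with hu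
  have huL : LipschitzOnWith K u (Icc 0 1) := lipschitzOnWith_coord hK s
  have huT : InjOn u T := fun t ht t' ht' htt =>
    hh.injective ht.1 ht'.1 (hinj ⟨ht.2, mem_arc h ht.1⟩ ⟨ht'.2, mem_arc h ht'.1⟩ htt)
  obtain ⟨η, hη, hmono⟩ := exists_sign_strictMonoOn hTconn
    (huL.continuousOn.mono fun t ht => ht.1) huT
  have hnhds : ∀ t ∈ T, t ∈ Ioo (0 : ℝ) 1 → T ∈ 𝓝 t := by
    intro t ht htO
    have hc : ContinuousAt h t := hh.continuousOn.continuousAt (Icc_mem_nhds htO.1 htO.2)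
    filter_upwards [Icc_mem_nhds htO.1 htO.2, hc (Metric.isOpen_ball.mem_nhds ht.2)] with t' h1 h2
    exact ⟨h1, h2⟩
  have hderiv : ∀ t ∈ T, t ∈ Ioo (0 : ℝ) 1 → 0 ≤ η * deriv u t := by
    intro t ht htO
    have h1 := hmono.monotoneOn.derivWithin_nonneg (x := t)
    rw [derivWithin_of_mem_nhds (hnhds t ht htO)] at h1
    rwa [deriv_const_mul_field] at h1
  have hint : IntervalIntegrable (fun t => η * (cubeBump c r (h t) * deriv u t)) volume 0 1 :=
    (intervalIntegrable_form hK s (continuous_cubeBump c r) (by simp) (by simp)).const_mul η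
  set S : Set ℝ := Icc (0 : ℝ) 1 ∩ h ⁻¹' Metric.ball c (r / 2) with hS
  have hST : S ⊆ T := fun t ht => ⟨ht.1, Metric.ball_subset_ball (by linarith) ht.2⟩
  have hSm : MeasurableSet S := by
    obtain ⟨O, hO, hOS⟩ := (continuousOn_iff'.1 hh.continuousOn) _ (Metric.isOpen_ball (x := c)
      (ε := r / 2))
    rw [hS, inter_comm, hOS]
    exact hO.measurableSet.inter measurableSet_Icc
  have hproj : (fun x : Fin n → ℝ => x s) '' (Metric.ball c (r / 2) ∩ arc h) = u '' S := by
    ext v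
    constructor
    · rintro ⟨x, ⟨hxb, t, ht, rfl⟩, rfl⟩
      exact ⟨t, ⟨ht, hxb⟩, rfl⟩
    · rintro ⟨t, ⟨ht, htb⟩, rfl⟩
      exact ⟨h t, ⟨htb, mem_arc h ht⟩, rfl⟩
  have hmain := volume_image_le_integral huL inter_subset_left hSm (huT.mono hST) hint
    (fun t ht => by
      by_cases htT : t ∈ T
      · rw [mul_left_comm]
        exact mul_nonneg (cubeBump_nonneg _ hr _) (hderiv t htT ht)
      · rw [cubeBump_eq_zero fun hb => htT ⟨Ioo_subset_Icc_self ht, hb⟩]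
        simp)
    (fun t ht => by
      rw [cubeBump_eq_one hr ht.1.2, one_mul, ← abs_of_nonneg (hderiv t (hST ht.1) ht.2), abs_mul,
        hη, one_mul])
  rw [hproj]
  refine hmain.trans ?_
  rw [intervalIntegral.integral_const_mul]
  refine (le_abs_self _).trans ?_
  rw [abs_mul, hη, one_mul]
  rfl

include hh in
-- The coordinate takes two different values on a short piece of the arc near the center, hence all
-- values between them. Finiteness is also needed, since `toReal` sends `⊤` to `0`.
theorem volume_proj_pos (hr : 0 < r) (hc : c ∈ arc h)
    (hinj : InjOn (fun x : Fin n → ℝ => x s) (Metric.ball c r ∩ arc h)) :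
    0 < (volume ((fun x : Fin n → ℝ => x s) '' (Metric.ball c (r / 2) ∩ arc h))).toReal := by
  refine ENNReal.toReal_pos ?_ ?_
  · obtain ⟨t₀, ht₀, rfl⟩ := hc
    have hev : ∀ᶠ t in 𝓝[Icc 0 1] t₀, h t ∈ Metric.ball (h t₀) (r / 2) :=
      hh.continuousOn t₀ ht₀ (Metric.ball_mem_nhds _ (by positivity))
    obtain ⟨ε, hε, hball⟩ := Metric.mem_nhdsWithin_iff.1 hev
    obtain ⟨a, b, hab, haI, hbI, habε⟩ : ∃ a b : ℝ, a < b ∧ a ∈ Icc (0 : ℝ) 1 ∧ b ∈ Icc (0 : ℝ) 1 ∧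
        Icc a b ⊆ Metric.ball t₀ ε := by
      rcases ht₀.2.eq_or_lt with rfl | hlt
      · refine ⟨max 0 (1 - ε / 2), 1, max_lt one_pos (by linarith), ⟨le_max_left _ _,
          max_le zero_le_one (by linarith)⟩, by simp, fun t ht => ?_⟩
        rw [Metric.mem_ball, Real.dist_eq, abs_lt]
        have := (le_max_right 0 (1 - ε / 2)).trans ht.1
        constructor <;> linarith [ht.2]
      · refine ⟨t₀, min 1 (t₀ + ε / 2), lt_min hlt (by linarith), ht₀, ⟨le_min zero_le_one
          (by linarith [ht₀.1]), min_le_left _ _⟩, fun t ht => ?_⟩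
        rw [Metric.mem_ball, Real.dist_eq, abs_lt]
        have := ht.2.trans (min_le_right 1 (t₀ + ε / 2))
        constructor <;> linarith [ht.1]
    have hIcc : Icc a b ⊆ Icc (0 : ℝ) 1 := Icc_subset_Icc haI.1 hbI.2
    set u : ℝ → ℝ := fun t => h t s with hu
    have hmem : ∀ t ∈ Icc a b, h t ∈ Metric.ball (h t₀) (r / 2) :=
      fun t ht => hball ⟨habε ht, hIcc ht⟩
    have hne : u a ≠ u b := by
      intro he
      have hb' : ∀ t ∈ Icc a b, h t ∈ Metric.ball (h t₀) r := fun t ht =>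
        Metric.ball_subset_ball (by linarith) (hmem t ht)
      have h1 := hinj ⟨hb' a (left_mem_Icc.2 hab.le), mem_arc h haI⟩
        ⟨hb' b (right_mem_Icc.2 hab.le), mem_arc h hbI⟩ he
      exact hab.ne (hh.injective haI hbI h1)
    have hcont : ContinuousOn u (uIcc a b) := by
      rw [uIcc_of_le hab.le]
      exact (continuous_apply s).comp_continuousOn (hh.continuousOn.mono hIcc)
    have hsub : uIcc (u a) (u b) ⊆
        (fun x : Fin n → ℝ => x s) '' (Metric.ball (h t₀) (r / 2) ∩ arc h) := by
      refine (intermediate_value_uIcc hcont).trans ?_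
      rw [uIcc_of_le hab.le]
      rintro _ ⟨t, ht, rfl⟩
      exact ⟨h t, ⟨hmem t ht, mem_arc h (hIcc ht)⟩, rfl⟩
    intro h0
    have := measure_mono_null hsub h0
    rw [uIcc, Real.volume_Icc, ENNReal.ofReal_eq_zero, max_sub_min_eq_abs] at this
    exact hne (sub_eq_zero.1 (abs_nonpos_iff.1 this)).symm
  · have hsub : (fun x : Fin n → ℝ => x s) '' (Metric.ball c (r / 2) ∩ arc h) ⊆
        Metric.ball (c s) (r / 2) := by
      rintro _ ⟨x, ⟨hx, -⟩, rfl⟩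
      rw [Metric.mem_ball] at hx ⊢
      exact (dist_le_pi_dist x c s).trans_lt hx
    exact ne_top_of_le_ne_top measure_ball_lt_top.ne (measure_mono hsub)

end Arc

end MomentsCurve
end

noncomputable section
namespace MomentsCurve

open scoped unitInterval

variable {n k : ℕ}

/-! ### Polynomial forms separate real combinations of arcs -/

theorem moment_eq_lineIntegral (a b : ℝ) (G : ℝ → Fin n → ℝ) (d : Fin n → ℕ) (i : Fin n) :
    moment a b G d i = lineIntegral (fun x => ∏ j, x j ^ d j) i G a b := rfl

theorem continuous_monomial (d : Fin n → ℕ) : Continuous fun x : Fin n → ℝ => ∏ j, x j ^ d j := by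
  fun_prop

theorem lineIntegral_sum_mul {ι : Type*} [Fintype ι] {K : NNReal} {g : ℝ → Fin n → ℝ}
    (hg : LipschitzOnWith K g (Icc 0 1)) (s : Fin n) (τ : ι → ℝ) {P : ι → (Fin n → ℝ) → ℝ}
    (hP : ∀ i, Continuous (P i)) :
    lineIntegral (fun x => ∑ i, τ i * P i x) s g 0 1 = ∑ i, τ i * lineIntegral (P i) s g 0 1 := by
  simp only [lineIntegral]
  simp only [← intervalIntegral.integral_const_mul]
  rw [← intervalIntegral.integral_finsetSum]
  · simp only [Finset.sum_mul, mul_assoc]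
  · exact fun i _ => (intervalIntegrable_form hg s (hP i) (by simp) (by simp)).const_mul _

theorem intervalIntegrable_abs_deriv {K : NNReal} {g : ℝ → Fin n → ℝ}
    (hg : LipschitzOnWith K g (Icc 0 1)) :
    IntervalIntegrable (fun t => ∑ j, |deriv (fun u => g u j) t|) volume 0 1 := by
  have := IntervalIntegrable.sum (μ := volume) (a := (0 : ℝ)) (b := 1) Finset.univ
    (f := fun (j : Fin n) t => |deriv (fun u => g u j) t|)
    (fun j _ => (intervalIntegrable_deriv_coord hg j (by simp) (by simp)).abs)
  convert! this using 1
  ext t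
  simp

theorem arcLength_nonneg (g : ℝ → Fin n → ℝ) : 0 ≤ arcLength g :=
  intervalIntegral.integral_nonneg zero_le_one fun _ _ => Finset.sum_nonneg fun _ _ => abs_nonneg _

theorem abs_sum_lineIntegral_sub_le {K : NNReal} {g : ℝ → Fin n → ℝ}
    (hg : LipschitzOnWith K g (Icc 0 1)) {P Q : Fin n → (Fin n → ℝ) → ℝ}
    (hP : ∀ j, Continuous (P j)) (hQ : ∀ j, Continuous (Q j)) {E : ℝ}
    (hE : ∀ j, ∀ t ∈ Icc (0 : ℝ) 1, |P j (g t) - Q j (g t)| ≤ E) :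
    |∑ j, lineIntegral (P j) j g 0 1 - ∑ j, lineIntegral (Q j) j g 0 1| ≤ E * arcLength g := by
  have hsub : ∑ j, lineIntegral (P j) j g 0 1 - ∑ j, lineIntegral (Q j) j g 0 1 =
      ∫ t in (0 : ℝ)..1, ∑ j, (P j (g t) - Q j (g t)) * deriv (fun u => g u j) t := by
    rw [← Finset.sum_sub_distrib, intervalIntegral.integral_finsetSum]
    · refine Finset.sum_congr rfl fun j _ => ?_
      rw [lineIntegral, lineIntegral, ← intervalIntegral.integral_sub
        (intervalIntegrable_form hg j (hP j) (by simp) (by simp))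
        (intervalIntegrable_form hg j (hQ j) (by simp) (by simp))]
      simp only [sub_mul]
    · exact fun j _ => intervalIntegrable_form hg j ((hP j).sub (hQ j)) (by simp) (by simp)
  rw [hsub, arcLength, ← intervalIntegral.integral_const_mul, ← Real.norm_eq_abs]
  refine intervalIntegral.norm_integral_le_of_norm_le zero_le_one
    (Filter.Eventually.of_forall fun t ht => ?_) ((intervalIntegrable_abs_deriv hg).const_mul E)
  rw [Finset.mul_sum]
  refine (norm_sum_le _ _).trans (Finset.sum_le_sum fun j _ => ?_)
  rw [norm_mul]
  exact mul_le_mul_of_nonneg_right (hE j t (Ioc_subset_Icc_self ht)) (abs_nonneg _)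

variable {C : Set (Fin n → ℝ)} {h : Fin k → ℝ → Fin n → ℝ}

theorem IsLipschitzTriangulation.isCompact (hT : IsLipschitzTriangulation C h) : IsCompact C := by
  rw [← hT.union]
  exact isCompact_iUnion fun i => (hT.isArc i).isCompact

theorem exists_cube_lt {C : Set (Fin n → ℝ)} (hC : IsCompact C) {R : ℝ} (hR : cubeRadius C < R) :
    ∃ c : Fin n → ℝ, C ⊆ Metric.closedBall c R := by
  obtain ⟨R₀, hR₀⟩ := hC.isBounded.subset_closedBall (0 : Fin n → ℝ)
  have hne : {ρ : ℝ | ∃ c : Fin n → ℝ, C ⊆ Metric.closedBall c ρ}.Nonempty := ⟨R₀, 0, hR₀⟩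
  obtain ⟨ρ, ⟨c, hc⟩, hρ⟩ := exists_lt_of_csInf_lt hne hR
  exact ⟨c, hc.trans (Metric.closedBall_subset_closedBall hρ.le)⟩

theorem cubeRadius_nonneg {C : Set (Fin n → ℝ)} (hC : C.Nonempty) : 0 ≤ cubeRadius C := by
  refine Real.sInf_nonneg ?_
  rintro ρ ⟨c, hc⟩
  exact Metric.nonempty_closedBall.1 (hC.mono hc)

/-- If all these moments vanished, so would the integral of every polynomial form of that degree
over the combination `β`. A signed bump form has a large integral there, and is too well
approximated by such polynomial forms. -/
theorem exists_sum_moment_ne_zero (hT : IsLipschitzTriangulation C h) {c : Fin k → Fin n → ℝ}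
    {r : Fin k → ℝ} {s : Fin k → Fin n} (hstar : CubeCondition h c r s) {β : Fin k → ℝ}
    (hβ : β ≠ 0) :
    ∃ (D : Fin n → Fin (boundN C h c r s + 1)) (j : Fin n),
      ∑ i, β i * moment 0 1 (h i) (fun q => D q) j ≠ 0 := by
  set N := boundN C h c r s with hN
  by_contra hcon
  push Not at hcon
  obtain ⟨i₀, hi₀⟩ := Function.ne_iff.1 hβ
  have : Nonempty (Fin k) := ⟨i₀⟩
  choose K hK using fun i => (hT.isArc i).lipschitz
  set ρ := ⨅ i, r i with hρdef
  set l := ⨅ i, projLength h c r s i with hldef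
  set L := ⨆ i, arcLength (h i) with hLdef
  have hρ : 0 < ρ := by
    obtain ⟨i, hi⟩ := exists_eq_ciInf_of_finite (f := r)
    rw [hρdef, ← hi]; exact hstar.radius_pos i
  have hl : 0 < l := by
    obtain ⟨i, hi⟩ := exists_eq_ciInf_of_finite (f := projLength h c r s)
    rw [hldef, ← hi]
    exact volume_proj_pos (hT.isArc i) (hstar.radius_pos i) (hstar.center_mem i)
      (hstar.injective i)
  have hρr : ∀ i, ρ ≤ r i := fun i => ciInf_le (finite_range _).bddBelow i
  have hlp : ∀ i, l ≤ projLength h c r s i := fun i => ciInf_le (finite_range _).bddBelow i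
  have hLL : ∀ i, arcLength (h i) ≤ L := fun i =>
    le_ciSup (f := fun i => arcLength (h i)) (finite_range _).bddAbove i
  have hL : 0 ≤ L := (arcLength_nonneg _).trans (hLL i₀)
  have hCne : C.Nonempty := ⟨h i₀ 0, hT.arc_subset i₀ (mem_arc _ (by simp))⟩
  have hd := cubeRadius_nonneg hCne
  have hNlt : 2 * Real.pi * n * L * cubeRadius C < N * (ρ * l) := by
    rw [← div_lt_iff₀ (by positivity), hN, boundN]
    push_cast
    exact Nat.lt_floor_add_one _
  set κ := 2 * Real.pi * n * L with hκ
  have hκ0 : 0 ≤ κ := by positivity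
  -- `cubeRadius` is an infimum that need not be known to be attained, and it may be `0`. The strict
  -- inequality `hNlt` leaves room for a slightly larger cube.
  set δ := (N * (ρ * l) - κ * cubeRadius C) / (κ + 1) with hδ
  have hδpos : 0 < δ := div_pos (by linarith) (by positivity)
  have hδlt : κ * (cubeRadius C + δ) < N * (ρ * l) := by
    have : (κ + 1) * δ = N * (ρ * l) - κ * cubeRadius C := by rw [hδ]; field_simp
    nlinarith
  obtain ⟨c₀, hc₀⟩ := exists_cube_lt hT.isCompact (lt_add_of_pos_right (cubeRadius C) hδpos)
  set R := cubeRadius C + δ with hR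
  have hRpos : 0 < R := by positivity
  set J : Fin k → ℝ := fun i => lineIntegral (cubeBump (c i) (r i)) (s i) (h i) 0 1 with hJ
  have hJl : ∀ i, l ≤ |J i| := fun i => (hlp i).trans
    (volume_proj_le_abs_lineIntegral (hT.isArc i) (hstar.radius_pos i) (hstar.connected i)
      (hstar.injective i))
  set η : Fin k → ℝ := fun i => if 0 ≤ β i * J i then 1 else -1 with hη
  have hη1 : ∀ i, |η i| = 1 := fun i => by simp only [hη]; split_ifs <;> simp
  have hηJ : ∀ i, β i * (η i * J i) = |β i| * |J i| := fun i => by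
    rw [← abs_mul]
    simp only [hη]
    split_ifs with h0
    · rw [abs_of_nonneg h0]; ring
    · rw [abs_of_neg (not_le.1 h0)]; ring
  -- The bump of the `i`-th cube enters only the `dx_{s i}` component, with the sign that makes its
  -- contribution `|β i| * |J i|`.
  set τ : Fin n → Fin k → ℝ := fun j i => if s i = j then η i else 0 with hτ
  have hτ1 : ∀ j i, |τ j i| ≤ 1 := fun j i => by
    simp only [hτ]; split_ifs
    · exact (hη1 i).le
    · simp
  set f : Fin n → (Fin n → ℝ) → ℝ := fun j x => ∑ i, τ j i * cubeBump (c i) (r i) x with hf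
  have hfc : ∀ j, Continuous (f j) := fun j => by
    have := fun i => continuous_cubeBump (c i) (r i)
    simp only [hf]; fun_prop
  choose A hA using fun j => exists_polynomial_approx N (f j) (2 / ρ) (by positivity)
    (abs_sum_cubeBump_sub_le hρ hρr hstar.disjoint_cubes (hτ1 j)) c₀ R hRpos
  set E := 2 / ρ * R * n * (Real.pi / (N + 2)) with hE
  have hE0 : 0 ≤ E := by positivity
  have hEL : E * L < l := by
    have e : E * L = κ * R / (ρ * (N + 2)) := by rw [hE, hκ]; field_simp
    rw [e, div_lt_iff₀ (by positivity)]
    nlinarith [mul_pos hρ hl]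
  set P : Fin n → (Fin n → ℝ) → ℝ := fun j x =>
    ∑ D : Fin n → Fin (N + 1), A j D * ∏ q, x q ^ (D q : ℕ) with hP
  have hPc : ∀ j, Continuous (P j) := fun j => by simp only [hP]; fun_prop
  have hPzero : ∑ i, β i * ∑ j, lineIntegral (P j) j (h i) 0 1 = 0 := by
    have e : ∀ i j, lineIntegral (P j) j (h i) 0 1 =
        -- Expanding the polynomial turns its integral into the moments assumed to vanish on `β`.
        ∑ D : Fin n → Fin (N + 1), A j D * moment 0 1 (h i) (fun q => D q) j := fun i j =>
      lineIntegral_sum_mul (hK i) j (A j) fun D => continuous_monomial fun q => (D q : ℕ)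
    simp only [e, Finset.mul_sum]
    rw [Finset.sum_comm]
    refine Finset.sum_eq_zero fun j _ => ?_
    rw [Finset.sum_comm]
    refine Finset.sum_eq_zero fun D _ => ?_
    have e2 : ∀ i, β i * (A j D * moment 0 1 (h i) (fun q => D q) j) =
        A j D * (β i * moment 0 1 (h i) (fun q => D q) j) := fun i => by ring
    simp only [e2]
    rw [← Finset.mul_sum, hcon D j, mul_zero]
  have hfJ : ∀ i, ∑ j, lineIntegral (f j) j (h i) 0 1 = η i * J i := by
    intro i
    have e : ∀ j, lineIntegral (f j) j (h i) 0 1 =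
        τ j i * lineIntegral (cubeBump (c i) (r i)) j (h i) 0 1 := by
      intro j
      rw [hf, lineIntegral_sum_mul (hK i) j (τ j) fun q => continuous_cubeBump (c q) (r q)]
      refine Finset.sum_eq_single_of_mem i (Finset.mem_univ i) fun q _ hq => ?_
      have : lineIntegral (cubeBump (c q) (r q)) j (h i) 0 1 = 0 := by
        refine (intervalIntegral.integral_congr (g := fun _ => 0) fun t ht => ?_).trans (by simp)
        rw [uIcc_of_le zero_le_one] at ht
        simp only
        rw [cubeBump_eq_zero, zero_mul]
        intro hb
        have := hstar.disjoint_arcs q i hq.symm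
        exact (this.subset ⟨hb, mem_arc _ ht⟩ : h i t ∈ (∅ : Set (Fin n → ℝ)))
      rw [this, mul_zero]
    simp only [e, hτ, ite_mul, zero_mul]
    rw [Finset.sum_ite_eq]
    simp [hJ]
  have herr : ∀ i, |η i * J i - ∑ j, lineIntegral (P j) j (h i) 0 1| ≤ E * L := fun i => by
    rw [← hfJ i]
    refine (abs_sum_lineIntegral_sub_le (hK i) hfc hPc fun j t ht => ?_).trans
      (mul_le_mul_of_nonneg_left (hLL i) hE0)
    exact hA j _ (hc₀ (hT.arc_subset i (mem_arc _ ht)))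
  have hterm : ∀ i, |β i| * (l - E * L) ≤ β i * ∑ j, lineIntegral (P j) j (h i) 0 1 := by
    intro i
    set B := ∑ j, lineIntegral (P j) j (h i) 0 1
    have e1 : β i * (η i * J i - B) ≤ |β i| * (E * L) := by
      refine (le_abs_self _).trans ?_
      rw [abs_mul]
      exact mul_le_mul_of_nonneg_left (herr i) (abs_nonneg _)
    have e2 := mul_le_mul_of_nonneg_left (hJl i) (abs_nonneg (β i))
    rw [mul_sub, hηJ] at e1
    linarith
  have hpos : 0 < ∑ i, |β i| * (l - E * L) := by
    refine Finset.sum_pos' (fun i _ => mul_nonneg (abs_nonneg _) (by linarith))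
      ⟨i₀, Finset.mem_univ _, mul_pos (abs_pos.2 hi₀) (by linarith)⟩
  have := Finset.sum_le_sum fun i (_ : i ∈ Finset.univ) => hterm i
  linarith

/-! ### Moments of closed curves and homology -/

variable {Γ : Set (Fin n → ℝ)}

/-- The circle coordinate of an arc as a continuous map on the triangulated set. -/
def IsLipschitzTriangulation.coordMap {e : ℕ} {g : Fin e → ℝ → Fin n → ℝ}
    (hΓ : IsLipschitzTriangulation Γ g) (i : Fin e) : C(Γ, UnitAddCircle) where
  toFun x := arcCoord (g i) x
  continuous_toFun := (hΓ.continuousOn_arcCoord i).domRestrict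

theorem IsLipschitzTriangulation.lineIntegral_eq_sum_winding {e : ℕ} {g : Fin e → ℝ → Fin n → ℝ}
    (hΓ : IsLipschitzTriangulation Γ g) {y : Γ} (γ : Path y y) {G : ℝ → Fin n → ℝ} {K : NNReal}
    (hG : LipschitzOnWith K G (Icc 0 1)) (hγ : ∀ t : I, G t = γ t)
    {P : (Fin n → ℝ) → ℝ} (hP : Continuous P) (s : Fin n) :
    lineIntegral P s G 0 1 =
      ∑ i, winding (hΓ.coordMap i) γ * lineIntegral P s (g i) 0 1 := by
  choose θ hθ using fun i => exists_lift_path (hΓ.coordMap i) γ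
  have hG' : ∀ t (ht : t ∈ Icc (0 : ℝ) 1), G t = γ ⟨t, ht⟩ := fun t ht => hγ ⟨t, ht⟩
  rw [hΓ.lineIntegral_eq_sum hG (fun t ht => by rw [hG' t ht]; exact Subtype.prop _) ?_
    (fun i t => θ i (projIcc 0 1 zero_le_one t))
    (fun i => ((θ i).continuous.comp continuous_projIcc).continuousOn)
    (fun i t ht => by rw [projIcc_of_mem _ ht, hθ, hG' t ht]; rfl) hP s]
  · refine Finset.sum_congr rfl fun i _ => ?_
    rw [winding_eq _ γ (θ i) (θ i).continuous (hθ i)]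
    simp
  · rw [hG' 0 (by simp), hG' 1 (by simp)]
    exact congrArg Subtype.val (γ.source.trans γ.target.symm)

/-- The point is that the same integers `z` serve for all forms and for the homology class; this
transfers independence of the classes to the integrals. -/
theorem IsLipschitzTriangulation.exists_int_lineIntegral_eq (hT : IsLipschitzTriangulation C h)
    [PathConnectedSpace Γ] (x₀ : Γ) (hC : C ⊆ Γ) {y : Γ} (p : Path y y)
    (hpC : ∀ t, (p t : Fin n → ℝ) ∈ C) (hinj : InjOn p {t | t ≠ 1}) {G : ℝ → Fin n → ℝ}
    {K : NNReal} (hG : LipschitzOnWith K G (Icc 0 1)) (hGp : ∀ t : I, G t = p t) :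
    ∃ z : Fin k → ℤ, (∀ P : (Fin n → ℝ) → ℝ, Continuous P → ∀ s,
      lineIntegral P s G 0 1 = ∑ i, z i * lineIntegral P s (h i) 0 1) ∧
      h1Class x₀ p = ∑ i, z i • potential x₀ (hT.arcMap hC i) 1 := by
  have hcont : ∀ i, Continuous fun t : I => arcCoord (h i) (p t) := fun i =>
    (hT.continuousOn_arcCoord i).comp_continuous (by fun_prop) hpC
  choose θ hθ using fun i => exists_circle_lift ⟨_, hcont i⟩
  obtain ⟨z, hz, hclass⟩ := hT.h1Class_eq_sum x₀ hC p hpC hinj (fun i => (θ i).continuous)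
    (fun i t => hθ i t)
  refine ⟨z, fun P hP s => ?_, hclass⟩
  have hG' : ∀ t (ht : t ∈ Icc (0 : ℝ) 1), G t = p ⟨t, ht⟩ := fun t ht => hGp ⟨t, ht⟩
  rw [hT.lineIntegral_eq_sum hG (fun t ht => by rw [hG' t ht]; exact hpC _) ?_
    (fun i t => θ i (projIcc 0 1 zero_le_one t))
    (fun i => ((θ i).continuous.comp continuous_projIcc).continuousOn)
    (fun i t ht => by rw [projIcc_of_mem _ ht, hθ, hG' t ht]; rfl) hP s]
  · refine Finset.sum_congr rfl fun i _ => ?_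
    rw [← hz]
    simp
  · rw [hG' 0 (by simp), hG' 1 (by simp)]
    exact congrArg Subtype.val (p.source.trans p.target.symm)

/-- Moments do not change under affine reparametrization. -/
theorem moment_reparam {a b : ℝ} (hab : a < b) (G : ℝ → Fin n → ℝ) (d : Fin n → ℕ) (i : Fin n) :
    moment 0 1 (fun t => G (a + (b - a) * t)) d i = moment a b G d i := by
  have hne : b - a ≠ 0 := by linarith
  rw [moment, moment]
  have hder : ∀ t, deriv (fun u => G (a + (b - a) * u) i) t =
      (b - a) * deriv (fun u => G u i) (a + (b - a) * t) := by
    intro t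
    have h1 := deriv_comp_mul_left (b - a) (fun v => G (a + v) i) t
    rw [deriv_comp_const_add (f := fun v => G v i)] at h1
    simpa using h1
  simp only [hder]
  have := intervalIntegral.integral_comp_add_mul
    (fun t => (∏ j, G t j ^ d j) * deriv (fun u => G u i) t) hne a (a := 0) (b := 1)
  simp only [mul_zero, add_zero, mul_one, add_sub_cancel] at this
  have e : ∀ t : ℝ, (∏ j, G (a + (b - a) * t) j ^ d j) *
      ((b - a) * deriv (fun u => G u i) (a + (b - a) * t)) = (b - a) *
      ((∏ j, G (a + (b - a) * t) j ^ d j) * deriv (fun u => G u i) (a + (b - a) * t)) :=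
    fun t => by ring
  simp only [e]
  rw [intervalIntegral.integral_const_mul, this, smul_eq_mul, mul_inv_cancel_left₀ hne]

theorem IsClosedLipschitzMap.reparam {a b : ℝ} (hab : a < b) {G : ℝ → Fin n → ℝ}
    (hG : IsClosedLipschitzMap Γ a b G) :
    IsClosedLipschitzMap Γ 0 1 (fun t => G (a + (b - a) * t)) := by
  have hmaps : MapsTo (fun t => a + (b - a) * t) (Icc 0 1) (Icc a b) := fun t ht => by
    constructor <;> nlinarith [ht.1, ht.2]
  obtain ⟨K, hK⟩ := hG.lipschitz
  refine ⟨⟨K * ⟨b - a, by linarith⟩, hK.comp (LipschitzWith.lipschitzOnWith ?_) hmaps⟩, ?_,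
    hG.mapsTo.comp hmaps⟩
  · refine LipschitzWith.of_dist_le_mul fun x y => ?_
    rw [Real.dist_eq, Real.dist_eq, add_sub_add_left_eq_sub, ← mul_sub, abs_mul,
      abs_of_pos (by linarith)]
    rfl
  · simp [hG.closed]

/-- Expand both sides over a triangulation of `Γ` itself. The coefficients are winding numbers,
which depend additively on the class in `H₁`. -/
theorem exists_int_moment_eq_sum (hΓ : LipschitzTriangulable Γ) [PathConnectedSpace Γ] (x₀ : Γ)
    {m : ℕ} {y : Fin m → Γ} (p : ∀ j, Path (y j) (y j)) {g : Fin m → ℝ → Fin n → ℝ}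
    (hg : ∀ j, ∃ K, LipschitzOnWith K (g j) (Icc 0 1)) (hgp : ∀ j (t : I), g j t = p j t)
    (hspan : ∀ a, ∃ z : Fin m → ℤ, a = ∑ j, z j • h1Class x₀ (p j))
    {a b : ℝ} (hab : a < b) {G : ℝ → Fin n → ℝ} (hG : IsClosedLipschitzMap Γ a b G) :
    ∃ z : Fin m → ℤ, ∀ d i, moment a b G d i = ∑ j, z j * moment 0 1 (g j) d i := by
  obtain ⟨e, η, hη⟩ := hΓ
  obtain ⟨⟨K, hK⟩, hcl, hmaps⟩ := hG.reparam hab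
  set G' : ℝ → Fin n → ℝ := fun t => G (a + (b - a) * t) with hG'
  let γ : Path (⟨G' 0, hmaps (by simp)⟩ : Γ) ⟨G' 0, hmaps (by simp)⟩ :=
    { toFun := fun t => ⟨G' t, hmaps t.2⟩
      continuous_toFun := by
        refine Continuous.subtype_mk ?_ _
        exact hK.continuousOn.domRestrict
      source' := by simp
      target' := Subtype.ext hcl.symm }
  obtain ⟨z, hz⟩ := hspan (h1Class x₀ γ)
  choose Kg hKg using hg
  refine ⟨z, fun d i => ?_⟩
  have hw : ∀ q, winding (hη.coordMap q) γ = ∑ j, z j * winding (hη.coordMap q) (p j) := by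
    intro q
    obtain ⟨w, hw⟩ := exists_winding_hom x₀ (hη.coordMap q)
    rw [← hw, hz, map_sum]
    refine Finset.sum_congr rfl fun j _ => ?_
    rw [map_zsmul, hw, zsmul_eq_mul]
  rw [← moment_reparam hab, moment_eq_lineIntegral,
    hη.lineIntegral_eq_sum_winding γ hK (fun t => rfl) (continuous_monomial d) i]
  simp only [hw, moment_eq_lineIntegral, Finset.sum_mul]
  rw [Finset.sum_comm]
  refine Finset.sum_congr rfl fun j _ => ?_
  rw [hη.lineIntegral_eq_sum_winding (p j) (hKg j) (hgp j) (continuous_monomial d) i,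
    Finset.mul_sum]
  exact Finset.sum_congr rfl fun q _ => by ring

/-! ### Selection of moments and counting -/

theorem exists_injective_span_eq_top {ι : Type*} [Finite ι] {m : ℕ} (v : ι → Fin m → ℝ)
    (hv : Submodule.span ℝ (range v) = ⊤) :
    ∃ q : Fin m → ι, Function.Injective q ∧ Submodule.span ℝ (range (v ∘ q)) = ⊤ := by
  obtain ⟨κ, a, ha, hspan, hli⟩ := exists_linearIndependent' ℝ v
  rw [hv] at hspan
  have : Finite κ := Finite.of_injective a ha
  have := Fintype.ofFinite κ
  let b := Module.Basis.mk hli hspan.ge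
  have hcard : Fintype.card κ = m := by
    rw [← Module.finrank_eq_card_basis b, Module.finrank_fin_fun]
  let ε : Fin m ≃ κ := (Fintype.equivFinOfCardEq hcard).symm
  refine ⟨a ∘ ε, ha.comp ε.injective, ?_⟩
  rw [← Function.comp_assoc, ε.surjective.range_comp, hspan]

/-- A functional with coefficients `a` that kills all `v x` gives `β = B a`, which kills all `u x`;
since `M` is a left inverse of `B`, `β = 0` would force `a = 0`. -/
theorem span_moments_eq_top {ι : Type*} {m : ℕ} {v : ι → Fin m → ℝ} {u : ι → Fin k → ℝ}
    {B : Fin k → Fin m → ℝ} (M : Fin m → Fin k → ℝ) (hvu : ∀ x j, v x j = ∑ i, B i j * u x i)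
    (hMB : ∀ l j, ∑ i, M l i * B i j = if l = j then 1 else 0)
    (hu : ∀ β : Fin k → ℝ, β ≠ 0 → ∃ x, ∑ i, β i * u x i ≠ 0) :
    Submodule.span ℝ (range v) = ⊤ := by
  by_contra hne
  obtain ⟨f, hf0, hf⟩ := Submodule.exists_le_ker_of_lt_top _ (lt_top_iff_ne_top.2 hne)
  set a : Fin m → ℝ := fun j => f (Pi.single j 1) with ha
  have hfa : ∀ w : Fin m → ℝ, f w = ∑ j, a j * w j := fun w => by
    rw [LinearMap.pi_apply_eq_sum_univ f w]
    refine Finset.sum_congr rfl fun j _ => ?_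
    rw [smul_eq_mul, mul_comm]
    congr 2
    ext i
    simp [Pi.single_apply, eq_comm]
  set β : Fin k → ℝ := fun i => ∑ j, a j * B i j with hβ
  have hβ0 : β ≠ 0 := by
    intro h0
    refine hf0 (LinearMap.ext fun w => ?_)
    have ha0 : ∀ l, a l = 0 := fun l => by
      have e : ∑ i, M l i * β i = a l := by
        simp only [hβ, Finset.mul_sum]
        rw [Finset.sum_comm]
        have : ∀ j, ∑ i, M l i * (a j * B i j) = a j * if l = j then 1 else 0 := fun j => by
          rw [← hMB, Finset.mul_sum]
          exact Finset.sum_congr rfl fun i _ => by ring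
        simp [this]
      rw [← e, h0]; simp
    rw [hfa]
    simp [ha0]
  obtain ⟨x, hx⟩ := hu β hβ0
  refine hx ?_
  have h1 : f (v x) = 0 := hf (Submodule.subset_span (mem_range_self x))
  rw [← h1, hfa]
  simp only [hβ, hvu, Finset.sum_mul, Finset.mul_sum]
  rw [Finset.sum_comm]
  exact Finset.sum_congr rfl fun j _ => Finset.sum_congr rfl fun i _ => by ring

theorem floor_le_of_momentsGenerated {m N : ℕ} (hn : n ≠ 0) (hN : MomentsGenerated Γ m N) :
    ⌊((m : ℝ) / n) ^ (1 / (n : ℝ)) - 1⌋ ≤ (N : ℤ) := by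
  obtain ⟨D, J, -, hinj, hD, -⟩ := hN
  have hcard : m ≤ (N + 1) ^ n * n := by
    let F : Fin m → (Fin n → Fin (N + 1)) × Fin n :=
      fun q => (fun j => ⟨D q j, Nat.lt_succ_of_le (hD q j)⟩, J q)
    have hF : Function.Injective F := fun q q' hqq => hinj <| by
      simp only [F, Prod.mk.injEq] at hqq ⊢
      exact ⟨funext fun j => congrArg Fin.val (congrFun hqq.1 j), hqq.2⟩
    simpa using Fintype.card_le_of_injective F hF
  have hn0 : (0 : ℝ) < n := by exact_mod_cast Nat.pos_of_ne_zero hn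
  have h1 : ((m : ℝ) / n) ^ (1 / (n : ℝ)) ≤ N + 1 := by
    have h2 : (m : ℝ) / n ≤ ((N : ℝ) + 1) ^ n := by
      rw [div_le_iff₀ hn0]; exact_mod_cast hcard
    calc ((m : ℝ) / n) ^ (1 / (n : ℝ)) ≤ (((N : ℝ) + 1) ^ n) ^ (1 / (n : ℝ)) :=
          Real.rpow_le_rpow (by positivity) h2 (by positivity)
      _ = N + 1 := by
          rw [one_div, Real.pow_rpow_inv_natCast (by positivity) hn]
  have h2 := Int.floor_le (((m : ℝ) / n) ^ (1 / (n : ℝ)) - 1)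
  have h3 : ((⌊((m : ℝ) / n) ^ (1 / (n : ℝ)) - 1⌋ : ℤ) : ℝ) ≤ ((N : ℤ) : ℝ) := by
    push_cast; linarith
  exact_mod_cast h3

theorem moment_zero_exponent {K : NNReal} {g : ℝ → Fin n → ℝ} (hg : LipschitzOnWith K g (Icc 0 1))
    (hcl : g 0 = g 1) (i : Fin n) : moment 0 1 g (fun _ => 0) i = 0 := by
  have := integral_deriv_coord hg i (x := 0) (y := 1) (by simp) (by simp)
  simp only [moment, pow_zero, Finset.prod_const_one, one_mul]
  rw [this, hcl, sub_self]

end MomentsCurve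
end

/-! ### Assembly of the main theorem -/

theorem theorem3p4 {n : ℕ}
    (a b : ℝ) (hab : a < b) (F : ℝ → Fin n → ℝ) (hF : ∃ K, LipschitzOnWith K F (Set.Icc a b))
    (Γ : Set (Fin n → ℝ)) (hΓF : Γ = F '' Set.Icc a b)
    (hΓ : MomentsCurve.LipschitzTriangulable Γ)
    (x₀ : Γ) (m : ℕ) (hm : 1 ≤ m)
    (hπ : Nonempty (FundamentalGroup Γ x₀ ≃* FreeGroup (Fin m)))
    (y : Fin m → Γ) (p : ∀ j, Path (y j) (y j))
    (hp : ∀ j, MomentsCurve.IsSimpleClosedLipschitz (p j))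
    (hgen : MomentsCurve.GenerateH1 x₀ p)
    (k : ℕ) (h : Fin k → ℝ → Fin n → ℝ)
    (hT : MomentsCurve.IsLipschitzTriangulation (MomentsCurve.curveUnion p) h)
    (c : Fin k → Fin n → ℝ) (r : Fin k → ℝ) (s : Fin k → Fin n)
    (hstar : MomentsCurve.CubeCondition h c r s) :
    ∃ N : ℕ,
      max ⌊((m : ℝ) / n) ^ (1 / (n : ℝ)) - 1⌋ 1 ≤ (N : ℤ) ∧
      N ≤ MomentsCurve.boundN (MomentsCurve.curveUnion p) h c r s ∧
      MomentsCurve.MomentsGenerated Γ m N ∧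
      ∀ N' : ℕ, MomentsCurve.MomentsGenerated Γ m N' → N ≤ N' := by
  classical
  set N := MomentsCurve.boundN (MomentsCurve.curveUnion p) h c r s with hN
  have hconn : PathConnectedSpace Γ := by
    rw [← isPathConnected_iff_pathConnectedSpace, hΓF]
    obtain ⟨K, hK⟩ := hF
    exact ((convex_Icc a b).isPathConnected (Set.nonempty_Icc.2 hab.le)).image' hK.continuousOn
  have hCΓ : MomentsCurve.curveUnion p ⊆ Γ := by
    refine Set.iUnion_subset fun j => ?_
    rintro _ ⟨t, rfl⟩
    exact Subtype.prop _
  have hpC : ∀ j t, (p j t : Fin n → ℝ) ∈ MomentsCurve.curveUnion p := fun j t =>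
    Set.mem_iUnion.2 ⟨j, t, rfl⟩
  have hn : n ≠ 0 := by
    obtain ⟨i, -⟩ := hT.exists_arc (hpC ⟨0, hm⟩ 0)
    rintro rfl
    exact (s i).elim0
  -- the generators of the first homology group
  obtain ⟨iso⟩ := hπ
  have hclos : AddSubgroup.closure (Set.range fun j => MomentsCurve.h1Class x₀ (p j)) = ⊤ := by
    have hset : (Set.range fun j => MomentsCurve.h1Class x₀ (p j)) = Additive.toMul ⁻¹'
        {g : Abelianization (FundamentalGroup Γ x₀) |
          ∃ (j : Fin m) (q : Path x₀ (y j)), g = Abelianization.of (FundamentalGroup.fromPath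
            (Path.Homotopic.Quotient.mk ((q.trans (p j)).trans q.symm)))} := by
      ext g
      constructor
      · rintro ⟨j, rfl⟩
        exact ⟨j, PathConnectedSpace.somePath x₀ (y j), rfl⟩
      · rintro ⟨j, q, hq⟩
        exact ⟨j, (MomentsCurve.of_conj_loop x₀ (p j) q).symm.trans (congrArg Additive.ofMul hq.symm)⟩
    rw [hset, ← Subgroup.toAddSubgroup_closure]
    rw [MomentsCurve.GenerateH1] at hgen
    rw [hgen]
    rfl
  obtain ⟨⟨dual, hdual⟩, hspan⟩ := MomentsCurve.exists_dual_of_closure_eq_top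
    ((MulEquiv.toAdditive iso.abelianizationCongr).trans (FreeAbelianGroup.equivFinsupp (Fin m)))
    (fun j => MomentsCurve.h1Class x₀ (p j)) hclos
  -- parametrizations of the generators
  set g : Fin m → ℝ → Fin n → ℝ := fun j t => p j (Set.projIcc 0 1 zero_le_one t) with hg
  have hgp : ∀ j (t : unitInterval), g j t = p j t := fun j t => by simp [hg]
  have hgL : ∀ j, ∃ K, LipschitzOnWith K (g j) (Set.Icc 0 1) := fun j => by
    obtain ⟨K, hK⟩ := (hp j).1
    exact ⟨_, ((LipschitzWith.subtype_val Γ).comp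
      (hK.comp (LipschitzWith.projIcc zero_le_one))).lipschitzOnWith⟩
  have hgcl : ∀ j, g j 0 = g j 1 := fun j => by simp [hg]
  have hgC : ∀ j, MomentsCurve.IsClosedLipschitzMap Γ 0 1 (g j) := fun j =>
    ⟨hgL j, hgcl j, fun t _ => Subtype.prop _⟩
  have hB : ∀ j, ∃ z : Fin k → ℤ, (∀ P : (Fin n → ℝ) → ℝ, Continuous P → ∀ s,
      MomentsCurve.lineIntegral P s (g j) 0 1 =
        ∑ i, z i * MomentsCurve.lineIntegral P s (h i) 0 1) ∧
      MomentsCurve.h1Class x₀ (p j) =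
        ∑ i, z i • MomentsCurve.potential x₀ (hT.arcMap hCΓ i) 1 := fun j => by
    obtain ⟨K, hK⟩ := hgL j
    exact hT.exists_int_lineIntegral_eq x₀ hCΓ (p j) (hpC j) (hp j).2 hK (hgp j)
  choose B hBint hBclass using hB
  have htop : Submodule.span ℝ (Set.range fun (x : (Fin n → Fin (N + 1)) × Fin n) (j : Fin m) =>
      MomentsCurve.moment 0 1 (g j) (fun q => x.1 q) x.2) = ⊤ := by
    refine MomentsCurve.span_moments_eq_top
      (u := fun x i => MomentsCurve.moment 0 1 (h i) (fun q => x.1 q) x.2)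
      (B := fun i j => (B j i : ℝ))
      -- The left inverse: the dual basis of `H₁` evaluated on the classes of the arcs, each closed
      -- up by chosen paths to the base point.
      (fun l i => (dual l (MomentsCurve.potential x₀ (hT.arcMap hCΓ i) 1) : ℝ))
      (fun x j => hBint j _ (MomentsCurve.continuous_monomial _) _) (fun l j => ?_)
      (fun β hβ => ?_)
    · have h1 := hdual l j
      rw [hBclass j, map_sum] at h1
      simp only [map_zsmul, smul_eq_mul] at h1
      have h2 : ((∑ i, B j i * dual l (MomentsCurve.potential x₀ (hT.arcMap hCΓ i) 1) : ℤ) : ℝ) =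
          ((if l = j then 1 else 0 : ℤ) : ℝ) := by rw [h1]
      push_cast at h2
      rw [← h2]
      exact Finset.sum_congr rfl fun i _ => mul_comm _ _
    · obtain ⟨D, j, hD⟩ := MomentsCurve.exists_sum_moment_ne_zero hT hstar hβ
      exact ⟨(D, j), hD⟩
  have hcomb := fun {a b : ℝ} (hab : a < b) {G : ℝ → Fin n → ℝ}
    (hG : MomentsCurve.IsClosedLipschitzMap Γ a b G) =>
    MomentsCurve.exists_int_moment_eq_sum hΓ x₀ p hgL hgp hspan hab hG
  have hgenN : MomentsCurve.MomentsGenerated Γ m N := by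
    obtain ⟨q, hq, hqtop⟩ := MomentsCurve.exists_injective_span_eq_top _ htop
    have hcoef : ∀ (d : Fin n → ℕ) (i : Fin n), ∃ co : Fin m → ℝ, ∀ j,
        MomentsCurve.moment 0 1 (g j) d i = ∑ x, co x *
          MomentsCurve.moment 0 1 (g j) (fun l => (q x).1 l) (q x).2 := fun d i => by
      have hmem : (fun j => MomentsCurve.moment 0 1 (g j) d i) ∈ (⊤ : Submodule ℝ (Fin m → ℝ)) :=
        Submodule.mem_top
      rw [← hqtop, Submodule.mem_span_range_iff_exists_fun] at hmem
      obtain ⟨co, hco⟩ := hmem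
      refine ⟨co, fun j => ?_⟩
      have := congrFun hco j
      simpa using this.symm
    choose co hco using hcoef
    refine ⟨fun x l => (q x).1 l, fun x => (q x).2, co, ?_, fun x l => Nat.le_of_lt_succ (Fin.is_lt _),
      fun a b G hab hG d i => ?_⟩
    · intro x x' hxx
      simp only [Prod.mk.injEq] at hxx
      refine hq (Prod.ext (funext fun l => Fin.ext (congrFun hxx.1 l)) hxx.2)
    · obtain ⟨z, hz⟩ := hcomb hab hG
      simp only [hz, Finset.mul_sum]
      rw [Finset.sum_comm]
      refine Finset.sum_congr rfl fun j _ => ?_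
      rw [hco, Finset.mul_sum]
      exact Finset.sum_congr rfl fun x _ => by ring
  -- With exponents zero only integrals of `dg_i` remain, which vanish on closed curves. Then all
  -- moments of the generators vanish, against their spanning `ℝ^m` with `m ≥ 1`.
  have hone : ∀ N', MomentsCurve.MomentsGenerated Γ m N' → 1 ≤ N' := by
    intro N' hN'
    by_contra h0
    obtain rfl : N' = 0 := by omega
    obtain ⟨D, J, co, -, hD, hmom⟩ := hN'
    have hzero : ∀ j d i, MomentsCurve.moment 0 1 (g j) d i = 0 := fun j d i => by
      obtain ⟨K, hK⟩ := hgL j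
      rw [hmom 0 1 (g j) zero_lt_one (hgC j) d i]
      refine Finset.sum_eq_zero fun q _ => ?_
      have : D q = fun _ => 0 := funext fun l => Nat.le_zero.1 (hD q l)
      rw [this, MomentsCurve.moment_zero_exponent hK (hgcl j), mul_zero]
    have hbot : Submodule.span ℝ (Set.range fun (x : (Fin n → Fin (N + 1)) × Fin n) (j : Fin m) =>
        MomentsCurve.moment 0 1 (g j) (fun q => x.1 q) x.2) = ⊥ := by
      rw [Submodule.span_eq_bot]
      rintro _ ⟨x, rfl⟩
      exact funext fun j => hzero j _ _
    have : Nontrivial (Fin m → ℝ) := by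
      have : Nonempty (Fin m) := ⟨⟨0, hm⟩⟩
      infer_instance
    exact bot_ne_top (hbot.symm.trans htop)
  have hex : ∃ N, MomentsCurve.MomentsGenerated Γ m N := ⟨N, hgenN⟩
  refine ⟨Nat.find hex, max_le ?_ ?_, Nat.find_min' hex hgenN, Nat.find_spec hex,
    fun N' hN' => Nat.find_min' hex hN'⟩
  · exact MomentsCurve.floor_le_of_momentsGenerated hn (Nat.find_spec hex)
  · exact_mod_cast hone _ (Nat.find_spec hex)
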